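/- Let $Z=\{1,\dots,2k+1\}$ and let $\mathcal H$ be the class of all $h:Z\to\{0,1\}$ that take the value $1$ exactly $k$ times. For a graph $G=(V,E)$ let $\mathcal C_{G,k}$ be the concept class on the domain $(V\times Z)\sqcup(Z\times V)$ that consists of the concepts $c_h$ ($h\in\mathcal H$), with $c_h((v,z))=h(z)$ and $c_h((z,v))=1$, and the concepts $c_{u,h}$ ($u\in V$, $h\in\mathcal H$), with $c_{u,h}((v,z))=0$ iff $v$ dominates $u$ (that is, $v=u$ or $v$ is adjacent to $u$), and $c_{u,h}((z,v))=1$ iff $h(z)=1$ and $u=v$. The recursive teaching dimension $\mathrm{RTD}(\mathcal C)$ is the minimum of $\max_i|S_i|$ over all sequences $(c_1,S_1),\dots,(c_m,S_m)$ with $\mathcal C=\{c_1,\dots,c_m\}$ such that, for each $i$, $c_i|_{S_i}\ne c'|_{S_i}$ for every $c'\in\{c_i,\dots,c_m\}\setminus\{c_i\}$. There is a single (multi-stack) Turing machine that, given $k\ge 0$ (in unary) and the adjacency matrix of an $N$-vertex graph $G$, halts after $2^{O(k)}N^{O(1)}$ steps and outputs $k$ together with $\mathcal C_{G,k}$ written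 explicitly as a boolean matrix (its rows are the concepts, its columns are the points of the domain in some order; the rows are pairwise distinct when $k,N\ge 1$). Moreover, $G$ has a dominating set of size at most $k$ if and only if $\mathrm{RTD}(\mathcal C_{G,k})\le k$; in particular, when $k\le N$, $G$ has a dominating set of size exactly $k$ if and only if $\mathrm{RTD}(\mathcal C_{G,k})\le k$. Here the bound $2^{O(k)}N^{O(1)}$ means $2^{a(k+1)}(N+1)^{a}$ for some constant $a$ that does not depend on $k$, $N$ or $G$. -/

import Mathlib

/-! ### Concepts, teaching sets and recursive teaching dimension -/

/-- `S` is a teaching set of the concept `c` with respect to the concept class `C`: the restriction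
of `c` to `S` differs from the restriction to `S` of every other concept of `C`. -/
def IsTeachingSet {X : Type} (S : Finset X) (c : X → Bool) (C : Set (X → Bool)) : Prop :=
  ∀ c' ∈ C, c' ≠ c → ∃ x ∈ S, c x ≠ c' x

/-- A teaching plan `(c₁, S₁), …, (cₘ, Sₘ)` of the concept class `C`: the concepts of the sequence
are exactly those of `C`, and each `Sᵢ` is a teaching set of `cᵢ` with respect to
`{cᵢ, …, cₘ}`. -/
structure TeachingPlan {X : Type} (C : Set (X → Bool)) where
  length : ℕ
  concept : Fin length → (X → Bool)
  sample : Fin length → Finset X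
  range_concept : Set.range concept = C
  isTeachingSet : ∀ i, IsTeachingSet (sample i) (concept i) (concept '' Set.Ici i)

/-- The largest size of a sample in a teaching plan. -/
def TeachingPlan.cost {X : Type} {C : Set (X → Bool)} (P : TeachingPlan C) : ℕ :=
  Finset.univ.sup fun i => (P.sample i).card

/-- The recursive teaching dimension: the minimum cost of a teaching plan. -/
noncomputable def recursiveTeachingDim {X : Type} (C : Set (X → Bool)) : ℕ :=
  sInf (Set.range fun P : TeachingPlan C => P.cost)

/-- Over a finite domain every concept class has a teaching plan, so the minimum in the definition
of the recursive teaching dimension is over a nonempty set. -/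
theorem TeachingPlan.nonempty {X : Type} [Fintype X] (C : Set (X → Bool)) :
    Nonempty (TeachingPlan C) := by
  classical
  have hC : C.Finite := Set.toFinite C
  have : Fintype C := hC.fintype
  refine ⟨⟨Fintype.card C, fun i => ((Fintype.equivFin C).symm i : X → Bool),
    fun _ => Finset.univ, ?_, ?_⟩⟩
  · ext c
    constructor
    · rintro ⟨i, rfl⟩
      exact ((Fintype.equivFin C).symm i).2
    · intro h
      exact ⟨Fintype.equivFin C ⟨c, h⟩, by simp⟩
  · intro i c' _ hne
    by_contra hcon
    push Not at hcon
    exact hne (funext fun x => (hcon x (Finset.mem_univ x)).symm)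

/-! ### Dominating sets -/

/-- A vertex `u` dominates a vertex `v` if they are equal or adjacent. -/
def Dominates {V : Type} (G : SimpleGraph V) (u v : V) : Prop :=
  u = v ∨ G.Adj u v

instance {V : Type} [DecidableEq V] (G : SimpleGraph V) [DecidableRel G.Adj] (u v : V) :
    Decidable (Dominates G u v) :=
  inferInstanceAs (Decidable (u = v ∨ G.Adj u v))

/-- Every vertex is dominated by a vertex of `T`. -/
def IsDominatingSet {V : Type} (G : SimpleGraph V) (T : Finset V) : Prop :=
  ∀ v, ∃ u ∈ T, Dominates G u v

/-! ### The concept class built from a graph -/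

/-- The gadget: all concepts on a domain of `2k + 1` points that take the value one exactly
`k` times. -/
def gadget (k : ℕ) : Set (Fin (2 * k + 1) → Bool) :=
  {h | (Finset.univ.filter fun z => h z = true).card = k}

/-- The domain `(V × Z) ∪ (Z × V)`, where `Z` is the domain of the gadget. -/
abbrev RedDomain (V : Type) (k : ℕ) : Type :=
  (V × Fin (2 * k + 1)) ⊕ (Fin (2 * k + 1) × V)

/-- The concept `c_h`: equal to `h z` at `(v, z)`, and to one on `Z × V`. -/
def constraintConcept (V : Type) {k : ℕ} (h : Fin (2 * k + 1) → Bool) : RedDomain V k → Bool :=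
  Sum.elim (fun p => h p.2) (fun _ => true)

/-- The concept `c_{u,h}`: at `(v, z)` it is zero iff `v` dominates `u`; at `(z, v)` it is one iff
`h z = 1` and `u = v`. -/
def vertexConcept {V : Type} [DecidableEq V] (G : SimpleGraph V) [DecidableRel G.Adj] {k : ℕ}
    (u : V) (h : Fin (2 * k + 1) → Bool) : RedDomain V k → Bool :=
  Sum.elim (fun p => decide (¬ Dominates G p.1 u)) (fun p => decide (h p.1 = true ∧ u = p.2))

/-- The class of all `c_h` and all `c_{u,h}`, for `u` a vertex and `h` in the gadget. -/
def reductionClass {V : Type} [DecidableEq V] (G : SimpleGraph V) [DecidableRel G.Adj] (k : ℕ) :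
    Set (RedDomain V k → Bool) :=
  {c | ∃ h ∈ gadget k, c = constraintConcept V h} ∪
    {c | ∃ u : V, ∃ h ∈ gadget k, c = vertexConcept G u h}

/-! ### Instances as strings, and running time -/

/-- A number `k` and a boolean matrix as a string: `k` in unary, a comma, and then the rows, each
followed by a comma. -/
def encodeInstance (k : ℕ) {m n : ℕ} (M : Fin m → Fin n → Bool) : List Computability.Γ' :=
  List.replicate k (Computability.Γ'.bit true) ++ Computability.Γ'.comma ::
    (List.ofFn fun i =>
      (List.ofFn fun j => Computability.Γ'.bit (M i j)) ++ [Computability.Γ'.comma]).flatten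

/-- The instance `(G, k)` of the dominating set problem as a string: `k` and the adjacency
matrix of `G`. -/
def encodeGraphInstance {N : ℕ} (G : SimpleGraph (Fin N)) [DecidableRel G.Adj] (k : ℕ) :
    List Computability.Γ' :=
  encodeInstance k fun i j => decide (G.Adj i j)

/-- Started on the input string `s`, the Turing machine `M` halts with output `t` after at most
`b` steps. -/
def OutputsWithin (M : Turing.TM2ComputableAux Computability.Γ' Computability.Γ')
    (s t : List Computability.Γ') (b : ℕ) : Prop :=
  Nonempty (Turing.TM2OutputsInTime M.tm (s.map M.inputAlphabet.symm)
    (some (t.map M.outputAlphabet.symm)) b)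

/-! ### Recursive teaching dimension of the reduction class -/

/-! The gadget is rigid: at most `k` points that tell `h` apart from the other weight-`k` functions
are exactly the `k` ones of `h`. If a one `a` were missed, some `b` would lie outside both the
points and the ones, since these cover at most `2k` of `2k + 1` places, and exchanging `a` for `b`
in `h` could not be detected (`eq_onesOf_of_distinguishes`).

A plan of cost at most `k` on a nonempty graph cannot begin with `c_{u,h}`. The concepts `c_{u,h'}`
differ from it only at points `(z, u)`, so by rigidity its sample is the set of `(z, u)` with `h z =
1`, where `c_h` is also one (`not_isTeachingSet_vertexConcept`). So the plan begins with some `c_h`.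
By rigidity again, its sample has exactly one point `(v, z)` for each one `z` of `h`, and no room
for other points. At these points `c_h` is one, so telling `c_{u,h}` apart requires a sampled `v`
that dominates `u`: the sampled vertices dominate the graph
(`exists_isDominatingSet_of_isTeachingSet`).

Conversely, a dominating set of size at most `k` can be spread over the ones of `h`. The resulting
points `(f z, z)` teach `c_h` against the whole class. Once all `c_h` are gone, the points `(z, u)`
with `h z = 1` teach `c_{u,h}`, in any order.

For the running time, a small structured language over stacks is compiled to multi-stack machines,
with step bounds that compose along the syntax (`Runs`, `Advances`, `outputsWithin_machine`). The
program keeps a template with one cell per pair (row, vertex), generates all `2 ^ (2k + 1)` words,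
and instantiates the template for each word with `k` ones (`runs_program`). `encodeWords_classRows`
and `mem_classRows` identify the written string with the concept class. -/

theorem IsTeachingSet.mono {X : Type} {S : Finset X} {c : X → Bool} {C C' : Set (X → Bool)}
    (h : IsTeachingSet S c C) (hC : C' ⊆ C) : IsTeachingSet S c C' :=
  fun c' hc' => h c' (hC hc')

/-- The forward direction needs that a plan exists: `sInf` of an empty set would be zero without
being attained. -/
theorem recursiveTeachingDim_le_iff {X : Type} [Fintype X] {C : Set (X → Bool)} {k : ℕ} :
    recursiveTeachingDim C ≤ k ↔ ∃ P : TeachingPlan C, P.cost ≤ k := by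
  constructor
  · intro h
    have := TeachingPlan.nonempty C
    obtain ⟨P, hP⟩ := Nat.sInf_mem (Set.range_nonempty fun P : TeachingPlan C => P.cost)
    exact ⟨P, hP.trans_le h⟩
  · rintro ⟨P, hP⟩
    exact (Nat.sInf_le (Set.mem_range_self P)).trans hP

/-- The empty teaching plan. -/
def TeachingPlan.empty (X : Type) : TeachingPlan (∅ : Set (X → Bool)) where
  length := 0
  concept := Fin.elim0
  sample := Fin.elim0
  range_concept := by simp
  isTeachingSet i := i.elim0

/-- Put one more concept in front of a teaching plan. -/
def TeachingPlan.cons {X : Type} {C : Set (X → Bool)} (P : TeachingPlan C) (c : X → Bool)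
    (S : Finset X) (h : IsTeachingSet S c (insert c C)) : TeachingPlan (insert c C) where
  length := P.length + 1
  concept := Fin.cons c P.concept
  sample := Fin.cons S P.sample
  range_concept := by rw [Fin.range_cons, P.range_concept]
  isTeachingSet i := by
    refine Fin.cases ?_ (fun i => ?_) i
    · refine h.mono ?_
      rintro _ ⟨j, -, rfl⟩
      refine Fin.cases (Or.inl rfl) (fun j => Or.inr ?_) j
      exact P.range_concept.subset ⟨j, rfl⟩
    · refine (P.isTeachingSet i).mono ?_
      rintro _ ⟨j, hj, rfl⟩
      obtain ⟨j, rfl⟩ := Fin.exists_succ_eq.2 (ne_of_gt ((Fin.succ_pos i).trans_le hj))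
      exact ⟨j, Fin.succ_le_succ_iff.1 hj, by simp⟩

theorem TeachingPlan.cost_cons_le {X : Type} {C : Set (X → Bool)} {P : TeachingPlan C}
    {c : X → Bool} {S : Finset X} {h : IsTeachingSet S c (insert c C)} {k : ℕ} (hP : P.cost ≤ k)
    (hS : S.card ≤ k) : (P.cons c S h).cost ≤ k := by
  refine Finset.sup_le fun i _ => ?_
  refine Fin.cases ?_ (fun i => ?_) i
  · exact hS
  · exact (Finset.le_sup (f := fun i => (P.sample i).card) (Finset.mem_univ i)).trans hP

/-- If the concepts of `C` have small teaching sets with respect to `C ∪ D`, they can be put in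
front of a teaching plan of `D`. -/
theorem TeachingPlan.exists_union {X : Type} {C D : Set (X → Bool)} {k : ℕ} (hC : C.Finite)
    (h : ∀ c ∈ C, ∃ S : Finset X, S.card ≤ k ∧ IsTeachingSet S c (C ∪ D))
    (hD : ∃ P : TeachingPlan D, P.cost ≤ k) : ∃ P : TeachingPlan (C ∪ D), P.cost ≤ k := by
  refine Set.Finite.induction_on_subset (motive := fun C' _ =>
    ∃ P : TeachingPlan (C' ∪ D), P.cost ≤ k) C hC ?_ ?_
  · rwa [Set.empty_union]
  · rintro c C' hc hC' - ⟨P, hP⟩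
    obtain ⟨S, hS, hcS⟩ := h c hc
    rw [Set.insert_union]
    have hsub : insert c (C' ∪ D) ⊆ C ∪ D :=
      Set.insert_subset (Or.inl hc) (Set.union_subset_union_left _ hC')
    exact ⟨P.cons c S (hcS.mono hsub), cost_cons_le hP hS⟩

/-- The first concept of a teaching plan has a small teaching set. -/
theorem TeachingPlan.exists_isTeachingSet {X : Type} {C : Set (X → Bool)} (P : TeachingPlan C)
    (hC : C.Nonempty) : ∃ c ∈ C, ∃ S : Finset X, S.card ≤ P.cost ∧ IsTeachingSet S c C := by
  obtain ⟨c, hc⟩ := hC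
  rw [← P.range_concept] at hc
  obtain ⟨i, -⟩ := hc
  let j : Fin P.length := ⟨0, i.pos⟩
  refine ⟨P.concept j, P.range_concept.subset ⟨j, rfl⟩, P.sample j,
    Finset.le_sup (f := fun i => (P.sample i).card) (Finset.mem_univ j),
    (P.isTeachingSet j).mono ?_⟩
  intro c' hc'
  rw [← P.range_concept] at hc'
  obtain ⟨i, rfl⟩ := hc'
  exact ⟨i, Nat.zero_le _, rfl⟩

/-- A teaching plan of a class, as a teaching plan of the class over a renumbered domain. -/
def TeachingPlan.comap {X Y : Type} {C : Set (X → Bool)} (P : TeachingPlan C) (e : Y ≃ X) :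
    TeachingPlan ((fun c => c ∘ e) '' C) where
  length := P.length
  concept i := P.concept i ∘ e
  sample i := (P.sample i).map e.symm.toEmbedding
  range_concept := (Set.range_comp (fun c => c ∘ e) _).trans (congrArg _ P.range_concept)
  isTeachingSet i := by
    rintro _ ⟨j, hj, rfl⟩ hne
    obtain ⟨x, hx, hxne⟩ := P.isTeachingSet i (P.concept j) ⟨j, hj, rfl⟩
      fun h => hne (by simp [h])
    exact ⟨e.symm x, by simpa using hx, by simpa using hxne⟩

theorem TeachingPlan.cost_comap {X Y : Type} {C : Set (X → Bool)} (P : TeachingPlan C)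
    (e : Y ≃ X) : (P.comap e).cost = P.cost := by
  simp only [cost, comap, Finset.card_map]
  rfl

/-- Plans can be transported along `e` and back along `e.symm` at equal cost. This makes the order
of the matrix columns irrelevant. -/
theorem recursiveTeachingDim_image_comp {X Y : Type} [Fintype X] [Fintype Y]
    (C : Set (X → Bool)) (e : Y ≃ X) :
    recursiveTeachingDim ((fun c => c ∘ e) '' C) = recursiveTeachingDim C := by
  apply le_antisymm
  · obtain ⟨P, hP⟩ := recursiveTeachingDim_le_iff.1 (le_refl (recursiveTeachingDim C))
    exact recursiveTeachingDim_le_iff.2 ⟨P.comap e, (P.cost_comap e).trans_le hP⟩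
  · obtain ⟨P, hP⟩ := recursiveTeachingDim_le_iff.1
      (le_refl (recursiveTeachingDim ((fun c => c ∘ e) '' C)))
    have hC : (fun c => c ∘ e.symm) '' ((fun c => c ∘ e) '' C) = C := by
      rw [Set.image_image]
      simp [Function.comp_assoc]
    have := recursiveTeachingDim_le_iff.2 ⟨P.comap e.symm, (P.cost_comap e.symm).trans_le hP⟩
    rwa [hC] at this

/-! ### The gadget: `k`-subsets of `2k + 1` points -/

/-- The points at which `h` is one. -/
def onesOf {n : ℕ} (h : Fin n → Bool) : Finset (Fin n) :=
  Finset.univ.filter fun z => h z = true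

theorem mem_onesOf {n : ℕ} {h : Fin n → Bool} {z : Fin n} : z ∈ onesOf h ↔ h z = true := by
  simp [onesOf]

theorem onesOf_injective {n : ℕ} : Function.Injective (onesOf (n := n)) := by
  intro h h' heq
  funext z
  have : h z = true ↔ h' z = true := by rw [← mem_onesOf, heq, mem_onesOf]
  exact Bool.eq_iff_iff.2 this

theorem onesOf_card {k : ℕ} {h : Fin (2 * k + 1) → Bool} : h ∈ gadget k ↔ (onesOf h).card = k :=
  Iff.rfl

theorem exists_mem_gadget_onesOf {k : ℕ} {s : Finset (Fin (2 * k + 1))} (hs : s.card = k) :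
    ∃ h ∈ gadget k, onesOf h = s := by
  have : onesOf (fun z => decide (z ∈ s)) = s := by ext; simp [mem_onesOf]
  exact ⟨_, by rw [onesOf_card, this, hs], this⟩

theorem exists_notMem_onesOf {k : ℕ} {h : Fin (2 * k + 1) → Bool} (hh : h ∈ gadget k) :
    ∃ z, z ∉ onesOf h := by
    by_contra! hcon
    have : (onesOf h).card = 2 * k + 1 := by
      rw [Finset.eq_univ_of_forall hcon, Finset.card_univ, Fintype.card_fin]
    rw [onesOf_card] at hh
    omega

theorem gadget_nonempty (k : ℕ) : (gadget k).Nonempty := by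
  obtain ⟨s, -, hs⟩ := Finset.exists_subset_card_eq (s := (Finset.univ : Finset (Fin (2 * k + 1))))
    (n := k) (by simp; omega)
  obtain ⟨h, hh, -⟩ := exists_mem_gadget_onesOf hs
  exact ⟨h, hh⟩

/-- At most `k` points that distinguish a concept of the gadget from all others are exactly the
points at which it is one. -/
theorem eq_onesOf_of_distinguishes {k : ℕ} {h : Fin (2 * k + 1) → Bool} (hh : h ∈ gadget k)
    {s : Finset (Fin (2 * k + 1))} (hs : s.card ≤ k)
    (hd : ∀ h' ∈ gadget k, h' ≠ h → ∃ z ∈ s, h z ≠ h' z) : s = onesOf h := by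
  rw [onesOf_card] at hh
  refine (Finset.eq_of_subset_of_card_le (fun a ha => ?_) (hs.trans hh.ge)).symm
  by_contra has
  -- Two sets of at most `k` points cannot cover all `2k + 1` points; this is why the gadget has
  -- that size.
  obtain ⟨b, hb⟩ : ∃ b, b ∉ s ∪ onesOf h := by
    by_contra! hcon
    have : (s ∪ onesOf h).card = 2 * k + 1 := by
      rw [Finset.eq_univ_of_forall hcon, Finset.card_univ, Fintype.card_fin]
    have := Finset.card_union_le s (onesOf h)
    omega
  rw [Finset.mem_union, not_or] at hb
  have hba : b ∉ (onesOf h).erase a := fun hm => hb.2 (Finset.mem_of_mem_erase hm)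
  -- Exchange `a` for `b`: the weight stays `k`, and no point of `s` sees the change.
  obtain ⟨h', hh', hones⟩ := exists_mem_gadget_onesOf (k := k)
    (s := insert b ((onesOf h).erase a)) (by
      rw [Finset.card_insert_of_notMem hba, Finset.card_erase_of_mem ha]
      have := Finset.card_pos.2 ⟨a, ha⟩
      omega)
  obtain ⟨z, hz, hne⟩ := hd h' hh' (by
    rintro rfl
    exact hb.2 (hones ▸ Finset.mem_insert_self _ _))
  refine hne (Bool.eq_iff_iff.2 ?_)
  rw [← mem_onesOf, ← mem_onesOf, hones, Finset.mem_insert, Finset.mem_erase]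
  have hzb : z ≠ b := by rintro rfl; exact hb.1 hz
  have hza : z ≠ a := by rintro rfl; exact has hz
  simp [hzb, hza]

/-! ### Small teaching sets in the reduction class -/

section Reduction

variable {V : Type} [DecidableEq V] (G : SimpleGraph V) [DecidableRel G.Adj] {k : ℕ}

/-- A concept that agrees at the points `(z, u)` is one there. As `k > 0` there is such a point,
which forces the same vertex; then the ones of `h` lie among those of `h'`, and equal cardinality
gives equality. -/
theorem isTeachingSet_vertexConcept {u : V} {h : Fin (2 * k + 1) → Bool} (hk : 0 < k)
    (hh : h ∈ gadget k) :
    IsTeachingSet ((onesOf h).map ⟨fun z => (Sum.inr (z, u) : RedDomain V k), fun _ _ => by simp⟩)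
      (vertexConcept G u h) {c | ∃ u : V, ∃ h ∈ gadget k, c = vertexConcept G u h} := by
  rintro _ ⟨u', h', hh', rfl⟩ hne
  by_contra! hcon
  have hone : ∀ z ∈ onesOf h, h' z = true ∧ u' = u := by
    intro z hz
    have : vertexConcept G u h (Sum.inr (z, u)) = vertexConcept G u' h' (Sum.inr (z, u)) :=
      hcon _ (Finset.mem_map_of_mem _ hz)
    simpa [vertexConcept, mem_onesOf.1 hz] using this
  obtain ⟨z, hz⟩ : (onesOf h).Nonempty := Finset.card_pos.1 (hh.symm ▸ hk)
  obtain rfl := (hone z hz).2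
  have : onesOf h = onesOf h' := Finset.eq_of_subset_of_card_le
    (fun z hz => mem_onesOf.2 (hone z hz).1) (hh'.trans hh.symm).le
  exact hne (by rw [onesOf_injective this])

theorem exists_isTeachingSet_constraintConcept {T : Finset V} (hT : IsDominatingSet G T)
    (hTk : T.card ≤ k) (hT0 : T.Nonempty) {h : Fin (2 * k + 1) → Bool} (hh : h ∈ gadget k) :
    ∃ S : Finset (RedDomain V k), S.card ≤ k ∧
      IsTeachingSet S (constraintConcept V h) (reductionClass G k) := by
  obtain ⟨f, hf⟩ : ∃ f : Fin (2 * k + 1) → V, T ⊆ (onesOf h).image f := by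
    have : T.card ≤ (onesOf h).card := hTk.trans hh.ge
    obtain ⟨s, hs, hsc⟩ := Finset.exists_subset_card_eq this
    have e : s ≃ T := Finset.equivOfCardEq hsc
    obtain ⟨t, ht⟩ := hT0
    -- `T` may have fewer than `k` elements, so the points outside `s` are sent to an arbitrary `t ∈
    -- T`; only surjectivity onto `T` matters.
    refine ⟨fun z => if hz : z ∈ s then e ⟨z, hz⟩ else t, fun v hv => ?_⟩
    refine Finset.mem_image.2 ⟨e.symm ⟨v, hv⟩, hs (e.symm ⟨v, hv⟩).2, ?_⟩
    simp
  refine ⟨(onesOf h).image fun z => Sum.inl (f z, z), Finset.card_image_le.trans hh.le, ?_⟩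
  have himage {p : RedDomain V k → Prop}
      (hp : ∀ x ∈ (onesOf h).image fun z => (Sum.inl (f z, z) : RedDomain V k), p x) :
      ∀ z ∈ onesOf h, p (Sum.inl (f z, z)) :=
    fun z hz => hp _ (Finset.mem_image_of_mem _ hz)
  rintro _ (⟨h', hh', rfl⟩ | ⟨u, h', hh', rfl⟩) hne
  · by_contra! hcon
    have : onesOf h = onesOf h' := Finset.eq_of_subset_of_card_le
      (fun z hz => mem_onesOf.2 ((himage hcon z hz).symm.trans (mem_onesOf.1 hz)))
      (hh'.trans hh.symm).le
    exact hne (by rw [onesOf_injective this])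
  · obtain ⟨v, hv, hvu⟩ := hT u
    obtain ⟨z, hz, rfl⟩ := Finset.mem_image.1 (hf hv)
    exact ⟨_, Finset.mem_image_of_mem _ hz,
      by simp [constraintConcept, vertexConcept, hvu, mem_onesOf.1 hz]⟩

theorem not_isTeachingSet_vertexConcept {u : V} {h : Fin (2 * k + 1) → Bool} (hh : h ∈ gadget k)
    {S : Finset (RedDomain V k)} (hS : S.card ≤ k) :
    ¬ IsTeachingSet S (vertexConcept G u h) (reductionClass G k) := by
  intro hT
  let s : Finset (Fin (2 * k + 1)) := Finset.univ.filter fun z => Sum.inr (z, u) ∈ S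
  let φ : Fin (2 * k + 1) ↪ RedDomain V k := ⟨fun z => Sum.inr (z, u), fun _ _ => by simp⟩
  have hsS : s.map φ ⊆ S := by
    intro x hx
    obtain ⟨z, hz, rfl⟩ := Finset.mem_map.1 hx
    exact (Finset.mem_filter.1 hz).2
  have hsk : s.card ≤ k := (Finset.card_map φ).symm.trans_le ((Finset.card_le_card hsS).trans hS)
  -- With `u` fixed, changing `h` only affects the points `(z, u)`, so the sampled ones among these
  -- must satisfy the rigidity of the gadget.
  have hsone : s = onesOf h := by
    refine eq_onesOf_of_distinguishes hh hsk fun h' hh' hne => ?_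
    have hne' : vertexConcept G u h' ≠ vertexConcept G u h := fun heq => hne (by
      funext z
      have := congrFun heq (Sum.inr (z, u))
      simpa [vertexConcept] using this)
    obtain ⟨x, hx, hxne⟩ := hT _ (Or.inr ⟨u, h', hh', rfl⟩) hne'
    rcases x with ⟨v, z⟩ | ⟨z, v⟩
    · exact absurd rfl hxne
    · by_cases huv : u = v
      · subst huv
        exact ⟨z, by simpa [s] using hx, fun heq => hxne (by simp [vertexConcept, heq])⟩
      · exact absurd (by simp [vertexConcept, huv]) hxne
  have hSeq : S = s.map φ :=
    (Finset.eq_of_subset_of_card_le hsS (by rw [Finset.card_map, hsone]; exact hS.trans hh.ge)).symm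
  -- A zero of `h` witnesses that `c_h` and `c_{u,h}` are different concepts, although they agree on
  -- all of `S`.
  obtain ⟨z, hz⟩ := exists_notMem_onesOf hh
  obtain ⟨x, hx, hxne⟩ := hT _ (Or.inl ⟨h, hh, rfl⟩) fun heq => hz (mem_onesOf.2 (by
    have := congrFun heq (Sum.inr (z, u))
    simpa [vertexConcept, constraintConcept] using this))
  rw [hSeq, hsone] at hx
  obtain ⟨z, hz, rfl⟩ := Finset.mem_map.1 hx
  have hxeq : vertexConcept G u h (Sum.inr (z, u)) = constraintConcept V h (Sum.inr (z, u)) := by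
    simp [vertexConcept, constraintConcept, mem_onesOf.1 hz]
  exact hxne hxeq

theorem exists_isDominatingSet_of_isTeachingSet {h : Fin (2 * k + 1) → Bool} (hh : h ∈ gadget k)
    [Nonempty V] {S : Finset (RedDomain V k)} (hS : S.card ≤ k)
    (hT : IsTeachingSet S (constraintConcept V h) (reductionClass G k)) :
    ∃ T : Finset V, IsDominatingSet G T ∧ T.card ≤ k := by
  let v₀ : V := Classical.arbitrary V
  let φ : RedDomain V k → Fin (2 * k + 1) := Sum.elim Prod.snd Prod.fst
  -- The concepts `c_h` are all equal on `Z × V`, so only sampled points of `V × Z` distinguish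
  -- them.
  have hsone : (S.filter fun x => x.isLeft).image φ = onesOf h := by
    refine eq_onesOf_of_distinguishes hh
      (Finset.card_image_le.trans ((Finset.card_filter_le _ _).trans hS)) fun h' hh' hne => ?_
    have hne' : constraintConcept V h' ≠ constraintConcept V h := fun heq => hne (by
      funext z
      exact congrFun heq (Sum.inl (v₀, z)))
    obtain ⟨x, hx, hxne⟩ := hT _ (Or.inl ⟨h', hh', rfl⟩) hne'
    rcases x with ⟨v, z⟩ | ⟨z, v⟩
    · exact ⟨z, Finset.mem_image.2 ⟨Sum.inl (v, z), Finset.mem_filter.2 ⟨hx, rfl⟩, rfl⟩, hxne⟩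
    · exact absurd rfl hxne
  refine ⟨S.image (Sum.elim Prod.fst Prod.snd), fun u => ?_, Finset.card_image_le.trans hS⟩
  obtain ⟨z, hz⟩ := exists_notMem_onesOf hh
  obtain ⟨x, hx, hxne⟩ := hT _ (Or.inr ⟨u, h, hh, rfl⟩) fun heq => hz (mem_onesOf.2 (by
    have := congrFun heq (Sum.inr (z, u))
    simpa [vertexConcept, constraintConcept] using this))
  -- The points in `V × Z` already project onto `k` elements, which exhausts the size of `S`.
  have hleft : (S.filter fun x => x.isLeft) = S := by
    refine Finset.eq_of_subset_of_card_le (Finset.filter_subset _ _) ?_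
    refine (hS.trans hh.ge).trans ((Finset.card_le_card hsone.ge).trans Finset.card_image_le)
  rcases x with ⟨v, z⟩ | ⟨z, v⟩
  · refine ⟨v, Finset.mem_image.2 ⟨_, hx, rfl⟩, ?_⟩
    have hz : h z = true := by
      rw [← mem_onesOf, ← hsone, hleft]
      exact Finset.mem_image_of_mem φ hx
    simpa [constraintConcept, vertexConcept, hz] using hxne
  · rw [← hleft] at hx
    exact absurd (Finset.mem_filter.1 hx).2 (by simp)

theorem exists_isDominatingSet_iff_recursiveTeachingDim_le [Fintype V] :
    (∃ T : Finset V, IsDominatingSet G T ∧ T.card ≤ k) ↔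
      recursiveTeachingDim (reductionClass G k) ≤ k := by
  rw [recursiveTeachingDim_le_iff]
  constructor
  · rintro ⟨T, hT, hTk⟩
    -- With nothing behind them, concepts that have small teaching sets within their own class form
    -- a plan in any order.
    have hempty := fun C : Set (RedDomain V k → Bool) => TeachingPlan.exists_union (C := C)
      (k := k) (Set.toFinite _) (hD := ⟨TeachingPlan.empty _, by simp [TeachingPlan.cost,
        TeachingPlan.empty]⟩)
    cases isEmpty_or_nonempty V
    · rw [← Set.union_empty (reductionClass G k)]
      -- Without vertices the domain is empty, so all concepts coincide.
      exact hempty _ fun c _ => ⟨∅, by simp, fun c' _ hne => absurd (Subsingleton.elim _ _) hne⟩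
    have hT0 : T.Nonempty := by
      obtain ⟨v, hv, -⟩ := hT (Classical.arbitrary V)
      exact ⟨v, hv⟩
    refine TeachingPlan.exists_union (Set.toFinite _) ?_ ?_
    · rintro _ ⟨h, hh, rfl⟩
      exact exists_isTeachingSet_constraintConcept G hT hTk hT0 hh
    · rw [← Set.union_empty {c | _}]
      refine hempty _ ?_
      rintro _ ⟨u, h, hh, rfl⟩
      rw [Set.union_empty]
      exact ⟨_, (Finset.card_map _).trans_le hh.le,
        isTeachingSet_vertexConcept G (hT0.card_pos.trans_le hTk) hh⟩
  · rintro ⟨P, hP⟩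
    cases isEmpty_or_nonempty V
    · exact ⟨∅, fun v => isEmptyElim v, by simp⟩
    obtain ⟨h, hh⟩ := gadget_nonempty k
    obtain ⟨_, (⟨h, hh, rfl⟩ | ⟨u, h, hh, rfl⟩), S, hS, hT⟩ :=
      P.exists_isTeachingSet ⟨_, Or.inl ⟨h, hh, rfl⟩⟩
    · exact exists_isDominatingSet_of_isTeachingSet G hh (hS.trans hP) hT
    · exact absurd hT (not_isTeachingSet_vertexConcept G hh (hS.trans hP))

end Reduction

/-! ### Structured programs over stacks, compiled to Turing machines -/

/-- A structured program that acts on stacks indexed by `K`, with symbols from `Γ`. -/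
inductive StackProg (K Γ : Type) : Type
  | skip : StackProg K Γ
  /-- Push a symbol. -/
  | push (k : K) (a : Γ) : StackProg K Γ
  /-- Pop a symbol (`none` if the stack is empty) and continue depending on the result. -/
  | pop (k : K) (f : Option Γ → StackProg K Γ) : StackProg K Γ
  | seq (p q : StackProg K Γ) : StackProg K Γ
  /-- As long as the stack `k` is not empty, pop a symbol `a` and run `f a`. -/
  | loop (k : K) (f : Γ → StackProg K Γ) : StackProg K Γ

namespace StackProg

variable {K Γ : Type}

/-- The labels used by the machine that runs a program. -/
def Label : StackProg K Γ → Type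
  | skip => Unit
  | push _ _ => Unit
  | pop _ f => Option (Σ o, Label (f o))
  | seq p q => Label p ⊕ Label q
  | loop _ f => Option (Σ a, Label (f a))

noncomputable instance fintypeLabel [Fintype Γ] : (p : StackProg K Γ) → Fintype (Label p)
  | skip => inferInstanceAs (Fintype Unit)
  | push _ _ => inferInstanceAs (Fintype Unit)
  | pop _ f =>
    haveI := fun o => fintypeLabel (f o)
    inferInstanceAs (Fintype (Option (Σ o, Label (f o))))
  | seq p q =>
    haveI := fintypeLabel p
    haveI := fintypeLabel q
    inferInstanceAs (Fintype (Label p ⊕ Label q))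
  | loop _ f =>
    haveI := fun a => fintypeLabel (f a)
    inferInstanceAs (Fintype (Option (Σ a, Label (f a))))

/-- The label at which a program starts. -/
def entry : (p : StackProg K Γ) → Label p
  | skip => ()
  | push _ _ => ()
  | pop _ _ => none
  | seq p _ => Sum.inl (entry p)
  | loop _ _ => none

/-- The statement at each label of a program, when the labels of the program are embedded by `e`
into those of a larger machine which continues at `exit`. -/
def stmt {Λ : Type} : (p : StackProg K Γ) → (Label p → Λ) → Λ → Label p →
    Turing.TM2.Stmt (fun _ : K => Γ) Λ (Option Γ)
  | skip, _, exit, _ => .goto fun _ => exit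
  | push k a, _, exit, _ => .push k (fun _ => a) (.goto fun _ => exit)
  | pop k f, e, _, none => .pop k (fun _ o => o) (.goto fun o => e (some ⟨o, entry (f o)⟩))
  | pop _ f, e, exit, some ⟨o, l⟩ => stmt (f o) (fun l => e (some ⟨o, l⟩)) exit l
  | seq p q, e, _, Sum.inl l => stmt p (fun l => e (Sum.inl l)) (e (Sum.inr (entry q))) l
  | seq _ q, e, exit, Sum.inr l => stmt q (fun l => e (Sum.inr l)) exit l
  | loop k f, e, exit, none => .pop k (fun _ o => o) (.goto fun o =>
      o.elim exit fun a => e (some ⟨a, entry (f a)⟩))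
  | loop _ f, e, _, some ⟨a, l⟩ => stmt (f a) (fun l => e (some ⟨a, l⟩)) (e none) l

/-! ### Execution of programs with step bounds -/

section Runs

variable [DecidableEq K]

/-- The machine reaches the configuration `c'` from `c` in at most `b` steps. -/
def StepsWithin {Λ : Type} (m : Λ → Turing.TM2.Stmt (fun _ : K => Γ) Λ (Option Γ))
    (c c' : Turing.TM2.Cfg (fun _ : K => Γ) Λ (Option Γ)) (b : ℕ) : Prop :=
  ∃ t ≤ b, (flip bind (Turing.TM2.step m))^[t] (some c) = some c'

theorem StepsWithin.trans {Λ : Type} {m : Λ → Turing.TM2.Stmt (fun _ : K => Γ) Λ (Option Γ)}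
    {c₁ c₂ c₃ : Turing.TM2.Cfg (fun _ : K => Γ) Λ (Option Γ)} {b₁ b₂ : ℕ}
    (h₁ : StepsWithin m c₁ c₂ b₁) (h₂ : StepsWithin m c₂ c₃ b₂) :
    StepsWithin m c₁ c₃ (b₁ + b₂) := by
  obtain ⟨t₁, ht₁, h₁⟩ := h₁
  obtain ⟨t₂, ht₂, h₂⟩ := h₂
  exact ⟨t₂ + t₁, by omega, by rw [Function.iterate_add_apply, h₁, h₂]⟩

theorem StepsWithin.single {Λ : Type} {m : Λ → Turing.TM2.Stmt (fun _ : K => Γ) Λ (Option Γ)}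
    {c c' : Turing.TM2.Cfg (fun _ : K => Γ) Λ (Option Γ)} (h : Turing.TM2.step m c = some c') :
    StepsWithin m c c' 1 :=
  ⟨1, le_rfl, h⟩

/-- Started with the stacks `S`, the program `p` ends with the stacks `S'` after at most `b`
steps. -/
def Runs (p : StackProg K Γ) (S S' : K → List Γ) (b : ℕ) : Prop :=
  ∀ ⦃Λ : Type⦄ (m : Λ → Turing.TM2.Stmt (fun _ : K => Γ) Λ (Option Γ)) (e : Label p → Λ)
    (exit : Λ), (∀ l, m (e l) = stmt p e exit l) →
    ∀ v, ∃ v', StepsWithin m ⟨some (e (entry p)), v, S⟩ ⟨some exit, v', S'⟩ b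

theorem Runs.mono {p : StackProg K Γ} {S S' : K → List Γ} {b b' : ℕ} (h : Runs p S S' b)
    (hb : b ≤ b') : Runs p S S' b' := by
  intro Λ m e exit hm v
  obtain ⟨v', t, ht, h⟩ := h m e exit hm v
  exact ⟨v', t, ht.trans hb, h⟩

theorem Runs.of_eq {p : StackProg K Γ} {S S' S'' : K → List Γ} {b b' : ℕ} (h : Runs p S S' b)
    (hS : S' = S'') (hb : b ≤ b') : Runs p S S'' b' :=
  hS ▸ h.mono hb

theorem Runs.of_eq_left {p : StackProg K Γ} {S S' T : K → List Γ} {b : ℕ} (h : Runs p T S' b)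
    (hS : S = T) : Runs p S S' b :=
  hS ▸ h

theorem Runs.skip (S : K → List Γ) : Runs skip S S 1 := fun Λ m e exit hm v =>
  ⟨v, .single (by simp [Turing.TM2.step, hm, stmt, Turing.TM2.stepAux])⟩

theorem Runs.push (k : K) (a : Γ) (S : K → List Γ) :
    Runs (push k a) S (Function.update S k (a :: S k)) 1 := fun Λ m e exit hm v =>
  ⟨v, .single (by simp [Turing.TM2.step, hm, stmt, Turing.TM2.stepAux])⟩

/-- `Runs` quantifies over the host machine, the embedding of labels and the exit label, so `p` can
be run with the entry of `q` as its exit. -/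
theorem Runs.seq {p q : StackProg K Γ} {S S' S'' : K → List Γ} {b b' : ℕ} (hp : Runs p S S' b)
    (hq : Runs q S' S'' b') : Runs (seq p q) S S'' (b + b') := by
  intro Λ m e exit hm v
  obtain ⟨v₁, h₁⟩ := hp m (fun l => e (Sum.inl l)) (e (Sum.inr (entry q)))
    (fun l => hm (Sum.inl l)) v
  obtain ⟨v₂, h₂⟩ := hq m (fun l => e (Sum.inr l)) exit (fun l => hm (Sum.inr l)) v₁
  exact ⟨v₂, h₁.trans h₂⟩

theorem Runs.pop {k : K} {f : Option Γ → StackProg K Γ} {S S' : K → List Γ} {b : ℕ}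
    (h : Runs (f (S k).head?) (Function.update S k (S k).tail) S' b) :
    Runs (pop k f) S S' (b + 1) := by
  intro Λ m e exit hm v
  obtain ⟨v', h⟩ := h m (fun l => e (some ⟨_, l⟩)) exit (fun l => hm (some ⟨_, l⟩)) (S k).head?
  refine ⟨v', add_comm 1 b ▸ StepsWithin.trans (.single ?_) h⟩
  exact congrArg (fun s => some (Turing.TM2.stepAux s v S)) (hm none)

theorem Runs.loop_nil {k : K} {f : Γ → StackProg K Γ} {S : K → List Γ} (hS : S k = []) :
    Runs (loop k f) S S 1 := by
  intro Λ m e exit hm v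
  -- Popping an empty stack leaves `none` in the internal state.
  refine ⟨none, .single ?_⟩
  refine (congrArg (fun s => some (Turing.TM2.stepAux s v S)) (hm none)).trans ?_
  have hu : Function.update S k [] = S := by rw [← hS, Function.update_eq_self]
  simp [stmt, Turing.TM2.stepAux, hS, hu]

theorem Runs.loop_cons {k : K} {f : Γ → StackProg K Γ} {S S' S'' : K → List Γ} {a : Γ}
    {l : List Γ} {b b' : ℕ} (hS : S k = a :: l) (h : Runs (f a) (Function.update S k l) S' b)
    (h' : Runs (loop k f) S' S'' b') : Runs (loop k f) S S'' (b + b' + 1) := by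
  intro Λ m e exit hm v
  obtain ⟨v₁, h₁⟩ := h m (fun l => e (some ⟨a, l⟩)) (e none) (fun l => hm (some ⟨a, l⟩)) (some a)
  obtain ⟨v₂, h₂⟩ := h' m e exit hm v₁
  refine ⟨v₂, add_comm 1 (b + b') ▸ StepsWithin.trans (.single ?_) (h₁.trans h₂)⟩
  refine (congrArg (fun s => some (Turing.TM2.stepAux s v S)) (hm none)).trans ?_
  simp [stmt, Turing.TM2.stepAux, hS]

end Runs

/-- The Turing machine that runs a program, with input stack `k₀` and output stack `k₁`. -/
noncomputable def machine [DecidableEq K] [Fintype K] [Fintype Γ] (k₀ k₁ : K)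
    (p : StackProg K Γ) : Turing.TM2ComputableAux Γ Γ where
  tm :=
    { K := K
      k₀ := k₀
      k₁ := k₁
      Γ := fun _ => Γ
      Λ := Option (Label p)
      main := some (entry p)
      σ := Option Γ
      initialState := none
      m := fun l => l.elim (.load (fun _ => none) .halt) (stmt p some none) }
  inputAlphabet := Equiv.refl _
  outputAlphabet := Equiv.refl _

theorem outputsWithin_machine [DecidableEq K] {k₀ k₁ : K}
    [Fintype K] {p : StackProg K Computability.Γ'} {s t : List Computability.Γ'} {b : ℕ}
    (h : Runs p (Function.update (fun _ => []) k₀ s) (Function.update (fun _ => []) k₁ t) b) :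
    OutputsWithin (machine k₀ k₁ p) s t (b + 1) := by
  obtain ⟨v, h⟩ := h (machine k₀ k₁ p).tm.m some none (fun l => rfl) none
  -- The additional step is the statement at the exit label, which resets the internal state, as a
  -- halting configuration requires, and halts.
  obtain ⟨n, hn, h⟩ := h.trans (b₂ := 1) (c₃ := ⟨none, none, Function.update (fun _ => []) k₁ t⟩)
    (.single rfl)
  refine ⟨⟨n, ?_⟩, hn⟩
  have hi : Turing.initList (machine k₀ k₁ p).tm (s.map (machine k₀ k₁ p).inputAlphabet.symm) =
      ⟨some (some (entry p)), none, Function.update (fun _ => []) k₀ s⟩ := by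
    unfold Turing.initList
    congr 1
    funext (k : K)
    rcases eq_or_ne k k₀ with rfl | hk
    · refine (dif_pos rfl).trans (Eq.trans ?_
        (Function.update_self (β := fun _ : K => List Computability.Γ') k
        s fun _ => []).symm)
      exact List.map_id s
    · exact (dif_neg hk).trans (Function.update_of_ne
        (β := fun _ : K => List Computability.Γ') hk s fun _ => []).symm
  have ho : Turing.haltList (machine k₀ k₁ p).tm (t.map (machine k₀ k₁ p).outputAlphabet.symm) =
      ⟨none, none, Function.update (fun _ => []) k₁ t⟩ := by
    unfold Turing.haltList
    congr 1
    funext (k : K)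
    rcases eq_or_ne k k₁ with rfl | hk
    · refine (dif_pos rfl).trans (Eq.trans ?_
        (Function.update_self (β := fun _ : K => List Computability.Γ') k
        t fun _ => []).symm)
      exact List.map_id t
    · exact (dif_neg hk).trans (Function.update_of_ne
        (β := fun _ : K => List Computability.Γ') hk t fun _ => []).symm
  rw [hi, Option.map_some, ho]
  exact h

end StackProg

/-! ### Rules for loops -/

namespace StackProg

variable {K Γ : Type} [DecidableEq K]

/-- Within at most `b` steps, the loop over the stack `k` with body `f` goes from the beginning of
an iteration with the stacks `S` to the beginning of an iteration with the stacks `S'`. -/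
def Advances (k : K) (f : Γ → StackProg K Γ) (S S' : K → List Γ) (b : ℕ) : Prop :=
  ∀ S'' b', Runs (loop k f) S' S'' b' → Runs (loop k f) S S'' (b + b')

theorem Advances.refl (k : K) (f : Γ → StackProg K Γ) (S : K → List Γ) : Advances k f S S 0 :=
  fun _ _ h => h.mono (by omega)

/-- Stating progress relative to any completion of the loop lets several iterations be grouped, for
instance all symbols of one word. -/
theorem Advances.trans {k : K} {f : Γ → StackProg K Γ} {S S' S'' : K → List Γ} {b b' : ℕ}
    (h : Advances k f S S' b) (h' : Advances k f S' S'' b') : Advances k f S S'' (b + b') :=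
  fun _ _ h'' => (h _ _ (h' _ _ h'')).mono (by omega)

theorem Advances.mono {k : K} {f : Γ → StackProg K Γ} {S S' : K → List Γ} {b b' : ℕ}
    (h : Advances k f S S' b) (hb : b ≤ b') : Advances k f S S' b' :=
  fun _ _ h' => (h _ _ h').mono (by omega)

theorem Advances.of_eq {k : K} {f : Γ → StackProg K Γ} {S S' T T' : K → List Γ} {b b' : ℕ}
    (h : Advances k f T T' b) (hS : S = T) (hS' : T' = S') (hb : b ≤ b') :
    Advances k f S S' b' := by
  subst hS hS'
  exact h.mono hb

theorem Advances.single {k : K} {f : Γ → StackProg K Γ} {S S' : K → List Γ} {a : Γ} {l : List Γ}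
    {b : ℕ} (hS : S k = a :: l) (h : Runs (f a) (Function.update S k l) S' b) :
    Advances k f S S' (b + 1) :=
  fun _ _ h' => (Runs.loop_cons hS h h').mono (by omega)

/-- Induction along a list: `I p r` are the stacks when `p` has been processed and `r` is left. -/
theorem Advances.list {ι : Type} {k : K} {f : Γ → StackProg K Γ} (I : List ι → List ι → K → List Γ)
    {b : ℕ} (l : List ι)
    (h : ∀ p a r, p ++ a :: r = l → Advances k f (I p (a :: r)) (I (p ++ [a]) r) b) :
    Advances k f (I [] l) (I l []) (l.length * b) := by
  suffices H : ∀ r p, p ++ r = l → Advances k f (I p r) (I l []) (r.length * b) from H l [] rfl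
  intro r
  induction r with
  | nil =>
    rintro p rfl
    rw [List.append_nil]
    exact (Advances.refl k f _).mono (by simp)
  | cons a r ih =>
    intro p hp
    refine ((h p a r hp).trans (ih (p ++ [a]) (by simpa using hp))).mono ?_
    rw [List.length_cons]
    exact (by ring : b + r.length * b = (r.length + 1) * b).le

theorem Advances.runs {k : K} {f : Γ → StackProg K Γ} {S S' : K → List Γ} {b : ℕ}
    (h : Advances k f S S' b) (hS' : S' k = []) : Runs (loop k f) S S' (b + 1) :=
  h _ _ (Runs.loop_nil hS')

/-- Induction along a list whose elements are popped one by one. -/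
theorem Runs.loop {k : K} {f : Γ → StackProg K Γ} {S S' : K → List Γ} {b : ℕ} (l : List Γ)
    (I : List Γ → List Γ → K → List Γ) (hS : S = I [] l) (hS' : I l [] = S')
    (hI : ∀ p r, I p r k = r)
    (h : ∀ p a r, p ++ a :: r = l →
      Runs (f a) (Function.update (I p (a :: r)) k r) (I (p ++ [a]) r) b) :
    Runs (loop k f) S S' (l.length * (b + 1) + 1) := by
  subst hS hS'
  exact (Advances.list I l fun p a r hp => Advances.single (hI _ _) (h p a r hp)).runs (hI _ _)

/-- Move the contents of the stack `A` to the stack `B`, in reverse order, and apply `g` to the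
symbols. -/
def transfer (g : Γ → Γ) (A B : K) : StackProg K Γ :=
  .loop A fun a => .push B (g a)

theorem runs_transfer (g : Γ → Γ) {A B : K} (hAB : A ≠ B) (S : K → List Γ) :
    Runs (transfer g A B) S
      (Function.update (Function.update S A []) B ((S A).reverse.map g ++ S B))
      (2 * (S A).length + 1) := by
  refine (Runs.loop (S A)
    (fun p r => Function.update (Function.update S A r) B (p.reverse.map g ++ S B))
    ?_ rfl ?_ ?_).mono (b := (S A).length * (1 + 1) + 1) (by omega)
  · simp
  · intro p r
    simp [Function.update_of_ne hAB]
  · intro p a r _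
    refine (Runs.push B (g a) _).of_eq ?_ le_rfl
    funext x
    simp only [Function.update_apply]
    split_ifs <;> simp_all

/-- Empty the stack `A`. -/
def clear (A : K) : StackProg K Γ :=
  .loop A fun _ => .skip

theorem runs_clear (A : K) (S : K → List Γ) :
    Runs (clear A) S (Function.update S A []) (2 * (S A).length + 1) := by
  refine (Runs.loop (S A) (fun p r => Function.update S A r) ?_ rfl ?_ ?_).mono
    (b := (S A).length * (1 + 1) + 1) (by omega)
  · simp
  · simp
  · intro p a r _
    exact (Runs.skip _).of_eq (by simp) le_rfl

end StackProg

/-! ### The program that writes the concept class of a graph -/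

/-- The stacks of the program. -/
inductive Stk
  | inp | out
  /-- `k`, in unary -/
  | num
  /-- `2 * k + 1`, in unary -/
  | pts
  /-- a list of bit strings -/
  | words
  /-- the rows of the concept class, in terms of cells -/
  | rows
  /-- one bit string -/
  | word
  /-- the number of ones of the bit string, in unary -/
  | ones
  | flag | tmp | tmp' | diag | diag'
  deriving DecidableEq

instance : Fintype Stk where
  elems := {.inp, .out, .num, .pts, .words, .rows, .word, .ones, .flag, .tmp, .tmp', .diag, .diag'}
  complete x := by cases x <;> decide

namespace ReductionProgram

open StackProg Stk Computability

local infixr:60 " ;; " => StackProg.seq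

/-! ### Writing the rows for one word -/

/-- Push the image of the bit string under `g` on the stack `A`. -/
def block (g : Γ' → Γ') (A : Stk) : StackProg Stk Γ' :=
  transfer id word tmp ;; .loop tmp fun a => .push word a ;; .push A (g a)

theorem runs_block (g : Γ' → Γ') {A : Stk} (hA : A ≠ word) (hA' : A ≠ tmp) {S : Stk → List Γ'}
    (hS : S tmp = []) :
    Runs (block g A) S (Function.update S A ((S word).map g ++ S A))
      (5 * (S word).length + 2) := by
  refine ((runs_transfer id (by decide) S).seq (Runs.loop (b := 2) (S word).reverse
    (fun p r => Function.update (Function.update (Function.update S tmp r) word p.reverse)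
      A (p.reverse.map g ++ S A)) ?_ ?_ ?_ ?_)).mono (by simp; omega)
  · funext x
    simp only [Function.update_apply]
    split_ifs <;> simp_all
  · funext x
    simp only [Function.update_apply]
    split_ifs <;> simp_all
  · intro p r
    simp [Function.update_of_ne hA'.symm]
  · intro p a r _
    refine ((Runs.push word a _).seq (Runs.push A (g a) _)).of_eq ?_ le_rfl
    funext x
    simp only [Function.update_apply]
    split_ifs <;> simp_all

/-- The part of a row that belongs to a cell, for the bit string `w`. -/
def emitted (w : List Γ') : Γ' → List Γ'
  | .bit b => w.map (fun _ => Γ'.bit !b) ++ w.map (fun _ => Γ'.bit false)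
  | .bra => w.map (fun _ => Γ'.bit false) ++ w
  | .ket => w ++ w.map (fun _ => Γ'.bit true)
  | .comma => [Γ'.comma]
  | .blank => []

/-- Write the part of a row that belongs to a cell. -/
def emit : Γ' → StackProg Stk Γ'
  | .bit b => block (fun _ => Γ'.bit false) out ;; block (fun _ => Γ'.bit !b) out
  | .bra => block id out ;; block (fun _ => Γ'.bit false) out
  | .ket => block (fun _ => Γ'.bit true) out ;; block id out
  | .comma => .push out .comma
  | .blank => .skip

theorem runs_emit (s : Γ') {S : Stk → List Γ'} (hS : S tmp = []) :
    Runs (emit s) S (Function.update S out (emitted (S word) s ++ S out))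
      (10 * (S word).length + 4) := by
  have hblock : ∀ g g' : Γ' → Γ', Runs (block g out ;; block g' out) S
      (Function.update S out (((S word).map g' ++ (S word).map g) ++ S out))
      (10 * (S word).length + 4) := by
    intro g g'
    refine ((runs_block g (by decide) (by decide) hS).seq
      (runs_block g' (by decide) (by decide) (by simpa using hS))).of_eq ?_ ?_
    · simp
    · simp only [ne_eq, reduceCtorEq, not_false_eq_true, Function.update_of_ne]
      omega
  cases s with
  | blank => exact (Runs.skip S).of_eq (by simp [emitted]) (by omega)
  | comma => exact (Runs.push out Γ'.comma S).of_eq (by simp [emitted]) (by omega)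
  | bit b => exact hblock _ _
  | bra => exact (hblock id fun _ => Γ'.bit false).of_eq (by simp [emitted]) le_rfl
  | ket => exact (hblock (fun _ => Γ'.bit true) id).of_eq (by simp [emitted]) le_rfl

/-- Write all rows for the present bit string. -/
def writeRows : StackProg Stk Γ' :=
  .loop rows (fun s => .push tmp' s ;; emit s) ;; transfer id tmp' rows

/-- The output stack is filled from its end, so the template lies on `rows` in reverse. It is saved
on `tmp'` and restored for the next word. -/
theorem runs_writeRows {S : Stk → List Γ'} (hS : S tmp = []) (hS' : S tmp' = []) :
    Runs writeRows S
      (Function.update S out ((S rows).reverse.flatMap (emitted (S word)) ++ S out))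
      ((S rows).length * (10 * (S word).length + 8) + 2) := by
  refine ((Runs.loop (b := 10 * (S word).length + 5) (S rows) (fun p r =>
    Function.update (Function.update (Function.update S rows r) tmp' p.reverse) out
      (p.reverse.flatMap (emitted (S word)) ++ S out)) ?_ rfl ?_ ?_).seq
      (runs_transfer id (by decide) _)).of_eq ?_ ?_
  · funext x
    cases x <;> simp [hS']
  · intro p r
    simp
  · intro p a r _
    refine ((Runs.push tmp' a _).seq (runs_emit a (by simpa using hS))).of_eq ?_ ?_
    · funext x
      cases x <;> simp
    · simp only [ne_eq, reduceCtorEq, not_false_eq_true, Function.update_of_ne]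
      omega
  · funext x
    cases x <;> simp [hS']
  · simp
    exact (by ring : _ = _).le

/-- Compare the number of ones with `k`, and write the rows if they agree. -/
def checkWord : StackProg Stk Γ' :=
  .loop num (fun a => .push tmp a ;; .pop ones fun o => o.elim (.push flag .bra) fun _ => .skip) ;;
  transfer id tmp num ;;
  .pop ones fun o => o.elim
    (.pop flag fun o' => o'.elim writeRows fun _ => clear flag)
    fun _ => clear ones

theorem runs_checkWord {S : Stk → List Γ'} (hS : S tmp = []) (hS' : S tmp' = [])
    (hflag : S flag = []) {w : ℕ} (hones : S ones = List.replicate w .bra) :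
    Runs checkWord S
      (Function.update (Function.update S ones []) out
        ((if w = (S num).length then (S rows).reverse.flatMap (emitted (S word)) else []) ++ S out))
      (8 * (S num).length + 2 * w + (S rows).length * (10 * (S word).length + 8) + 10) := by
  -- Each unit of `num` cancels a one or else leaves a mark on `flag`. The two truncated differences
  -- are what remains, and both vanish exactly when `w = k`.
  have h₁ : Runs (.loop num (fun a => .push tmp a ;; .pop ones fun o =>
      o.elim (.push flag Γ'.bra) fun _ => .skip)) S
      (Function.update (Function.update (Function.update (Function.update S num []) tmp
        (S num).reverse) ones (List.replicate (w - (S num).length) Γ'.bra)) flag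
        (List.replicate ((S num).length - w) Γ'.bra)) ((S num).length * (3 + 1) + 1) := by
    refine Runs.loop (S num) (fun p r =>
      Function.update (Function.update (Function.update (Function.update S num r) tmp p.reverse)
        ones (List.replicate (w - p.length) Γ'.bra)) flag (List.replicate (p.length - w) Γ'.bra))
      ?_ rfl ?_ ?_
    · funext x
      cases x <;> simp [hS, hflag, hones]
    · intro p r
      simp
    · intro p a r _
      refine (Runs.push tmp a _).seq (b' := 2) (Runs.pop (b := 1) ?_)
      cases hj : w - p.length with
      | zero =>
        refine (Runs.push flag Γ'.bra _).of_eq ?_ le_rfl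
        have : p.length + 1 - w = p.length - w + 1 := by omega
        have : w - (p.length + 1) = 0 := by omega
        funext x
        cases x <;> simp [*, List.replicate_succ]
      | succ j =>
        refine (Runs.skip _).of_eq ?_ le_rfl
        have : p.length + 1 - w = p.length - w := by omega
        have : w - (p.length + 1) = j := by omega
        funext x
        cases x <;> simp [*, List.replicate_succ]
  have h₂ := (runs_transfer id (A := tmp) (B := num) (by decide)
    (Function.update (Function.update (Function.update (Function.update S num []) tmp
        (S num).reverse) ones (List.replicate (w - (S num).length) Γ'.bra)) flag
        (List.replicate ((S num).length - w) Γ'.bra))).of_eq (S'' :=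
      Function.update (Function.update S ones (List.replicate (w - (S num).length) Γ'.bra)) flag
        (List.replicate ((S num).length - w) Γ'.bra)) (b' := 2 * (S num).length + 1)
    (by funext x; cases x <;> simp [hS]) (by simp)
  refine (h₁.seq (h₂.seq (b' := 2 * w +
    (S rows).length * (10 * (S word).length + 8) + 2 * (S num).length + 5)
    (Runs.pop (b := 2 * w + (S rows).length * (10 * (S word).length + 8) +
      2 * (S num).length + 4) ?_))).of_eq rfl (by omega)
  rcases lt_trichotomy w (S num).length with h | h | h
  · obtain ⟨j, hj⟩ := Nat.exists_eq_add_of_lt h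
    have e₁ : w - (S num).length = 0 := by omega
    have e₂ : (S num).length - w = j + 1 := by omega
    rw [e₁, e₂]
    refine Runs.pop (b := 2 * w + (S rows).length * (10 * (S word).length + 8) +
      2 * (S num).length + 3) ((runs_clear flag _).of_eq ?_ ?_)
    · funext x
      cases x <;> simp [h.ne, hflag]
    · simp
      omega
  · rw [← h, Nat.sub_self]
    refine Runs.pop (b := 2 * w + (S rows).length * (10 * (S word).length + 8) +
      2 * w + 3) ((runs_writeRows ?_ ?_).of_eq ?_ ?_)
    · simp [hS]
    · simp [hS']
    · funext x
      cases x <;> simp [hflag]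
    · simp
      omega
  · obtain ⟨j, hj⟩ := Nat.exists_eq_add_of_lt h
    have e₁ : (S num).length - w = 0 := by omega
    have e₂ : w - (S num).length = j + 1 := by omega
    rw [e₁, e₂]
    refine (runs_clear ones _).of_eq ?_ ?_
    · funext x
      cases x <;> simp [h.ne', hflag]
    · simp
      omega


/-- A list of bit strings as a string: each bit string is followed by a comma. -/
def encodeWords (L : List (List Bool)) : List Γ' :=
  L.flatMap fun l => l.map Γ'.bit ++ [Γ'.comma]

theorem encodeWords_cons (l : List Bool) (L : List (List Bool)) :
    encodeWords (l :: L) = l.map Γ'.bit ++ Γ'.comma :: encodeWords L := by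
  simp [encodeWords]

theorem length_encodeWords {L : List (List Bool)} {n : ℕ} (h : ∀ l ∈ L, l.length = n) :
    (encodeWords L).length = L.length * (n + 1) := by
  induction L with
  | nil => simp [encodeWords]
  | cons l L ih =>
    rw [encodeWords_cons, List.length_append, List.length_cons,
      ih fun l' hl' => h l' (List.mem_cons_of_mem l hl'), List.length_map,
      h l List.mem_cons_self, List.length_cons]
    ring

/-! #### Writing the rows for all words of weight `k` -/

/-- Read a symbol of a word, and write the rows at the end of the word. -/
def writeBody : Γ' → StackProg Stk Γ'
  | .comma => checkWord ;; clear word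
  | .bit true => .push word (.bit true) ;; .push ones .bra
  | s => .push word s

theorem advances_writeBody_bits (l : List Bool) (r : List Γ') {S : Stk → List Γ'}
    (hS : S words = l.map Γ'.bit ++ r) :
    Advances words writeBody S (Function.update (Function.update (Function.update S words r)
      word ((l.map Γ'.bit).reverse ++ S word))
      ones (List.replicate (l.count true) Γ'.bra ++ S ones)) (l.length * 3) := by
  have := Advances.list (k := words) (f := writeBody) (b := 3) (fun p q =>
    Function.update (Function.update (Function.update S words (q.map Γ'.bit ++ r))
      word ((p.map Γ'.bit).reverse ++ S word))
      ones (List.replicate (p.count true) Γ'.bra ++ S ones)) l ?_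
  · refine this.of_eq ?_ rfl le_rfl
    funext x
    cases x <;> simp [hS]
  · intro p a q _
    refine Advances.single (a := Γ'.bit a) (l := q.map Γ'.bit ++ r) (b := 2) (by simp) ?_
    cases a with
    | false =>
      refine (Runs.push word _ _).of_eq ?_ (by omega)
      funext x
      cases x <;> simp
    | true =>
      refine ((Runs.push word _ _).seq (Runs.push ones _ _)).of_eq ?_ le_rfl
      funext x
      cases x <;> simp [List.replicate_succ]

/-- The rows written for a word. -/
def rowsFor (k : ℕ) (cells : List Γ') (l : List Bool) : List Γ' :=
  if l.count true = k then cells.flatMap (emitted (l.map Γ'.bit).reverse) else []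

/-- Pushing the bits one by one reverses the word, hence the reversal in `rowsFor`. -/
theorem advances_writeBody_word (l : List Bool) (r : List Γ') {S : Stk → List Γ'}
    (hS : S words = l.map Γ'.bit ++ Γ'.comma :: r) (htmp : S tmp = []) (htmp' : S tmp' = [])
    (hflag : S flag = []) (hones : S ones = []) (hword : S word = []) :
    Advances words writeBody S (Function.update (Function.update S words r)
      out (rowsFor (S num).length (S rows).reverse l ++ S out))
      (7 * l.length + 8 * (S num).length + (S rows).length * (10 * l.length + 8) + 12) := by
  refine ((advances_writeBody_bits l (Γ'.comma :: r) hS).trans (Advances.single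
    (a := Γ'.comma) (l := r) (S' := Function.update (Function.update S words r)
      out (rowsFor (S num).length (S rows).reverse l ++ S out))
    (b := 4 * l.length + 8 * (S num).length + (S rows).length * (10 * l.length + 8) + 11)
    (by simp) ?_)).mono (by omega)
  refine ((runs_checkWord (w := l.count true) ?_ ?_ ?_ ?_).seq (runs_clear word _)).of_eq ?_ ?_
  · simp [htmp]
  · simp [htmp']
  · simp [hflag]
  · simp [hones]
  · funext x
    cases x <;> simp [rowsFor, hones, hword]
  · have := List.count_le_length (l := l) (a := true)
    simp [hword]
    omega

theorem runs_writeBody {L : List (List Bool)} {n : ℕ} (hL : ∀ l ∈ L, l.length = n)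
    {S : Stk → List Γ'} (hS : S words = encodeWords L) (htmp : S tmp = []) (htmp' : S tmp' = [])
    (hflag : S flag = []) (hones : S ones = []) (hword : S word = []) :
    Runs (.loop words writeBody) S (Function.update (Function.update S words [])
      out (L.reverse.flatMap (rowsFor (S num).length (S rows).reverse) ++ S out))
      (L.length * (7 * n + 8 * (S num).length + (S rows).length * (10 * n + 8) + 12) + 1) := by
  have := (Advances.list (k := words) (f := writeBody)
    (b := 7 * n + 8 * (S num).length + (S rows).length * (10 * n + 8) + 12) (fun p q =>
      Function.update (Function.update S words (encodeWords q))
        out (p.reverse.flatMap (rowsFor (S num).length (S rows).reverse) ++ S out)) L ?_).runs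
    (by simp [encodeWords])
  · refine this.of_eq_left ?_
    funext x
    cases x <;> simp [hS]
  · intro p l q hp
    obtain rfl := hL l (hp ▸ by simp)
    have := advances_writeBody_word l (encodeWords q) (S := Function.update (Function.update S words
      (encodeWords (l :: q))) out
        (p.reverse.flatMap (rowsFor (S num).length (S rows).reverse) ++ S out))
      (by simp [encodeWords_cons]) (by simp [htmp]) (by simp [htmp']) (by simp [hflag])
      (by simp [hones]) (by simp [hword])
    refine this.of_eq rfl ?_ (by simp)
    funext x
    cases x <;> simp

/-! #### Generating all words -/

/-- Extend each word by one bit, in both ways. -/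
def double (L : List (List Bool)) : List (List Bool) :=
  L.flatMap fun l => [l ++ [false], l ++ [true]]

theorem length_double (L : List (List Bool)) : (double L).length = 2 * L.length := by
  simp [double, mul_comm]

theorem length_of_mem_double {L : List (List Bool)} {n : ℕ} (h : ∀ l ∈ L, l.length = n) :
    ∀ l ∈ double L, l.length = n + 1 := by
  intro l hl
  obtain ⟨l', hl', hl⟩ := List.mem_flatMap.1 hl
  rcases List.mem_pair.1 hl with rfl | rfl <;> simp [h l' hl']

/-- Read a symbol of a word, and write the two extensions at the end of the word. -/
def doubleBody : Γ' → StackProg Stk Γ'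
  | .comma => block id tmp' ;; .push tmp' (.bit false) ;; .push tmp' .comma ;;
      block id tmp' ;; .push tmp' (.bit true) ;; .push tmp' .comma ;; clear word
  | s => .push word s

theorem advances_doubleBody_bits (l : List Bool) (r : List Γ') {S : Stk → List Γ'}
    (hS : S words = l.map Γ'.bit ++ r) :
    Advances words doubleBody S (Function.update (Function.update S words r)
      word ((l.map Γ'.bit).reverse ++ S word)) (l.length * 2) := by
  have := Advances.list (k := words) (f := doubleBody) (b := 2) (fun p q =>
    Function.update (Function.update S words (q.map Γ'.bit ++ r))
      word ((p.map Γ'.bit).reverse ++ S word)) l ?_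
  · refine this.of_eq ?_ rfl le_rfl
    funext x
    cases x <;> simp [hS]
  · intro p a q _
    refine Advances.single (a := Γ'.bit a) (l := q.map Γ'.bit ++ r) (b := 1) (by simp) ?_
    refine (Runs.push word _ _).of_eq ?_ le_rfl
    funext x
    cases x <;> simp

/-- The copied `word` is reversed, and so is everything collected on `tmp'`; the final transfer in
`doubleWords` restores the order. -/
theorem advances_doubleBody_word (l : List Bool) (r : List Γ') {S : Stk → List Γ'}
    (hS : S words = l.map Γ'.bit ++ Γ'.comma :: r) (htmp : S tmp = []) (hword : S word = []) :
    Advances words doubleBody S (Function.update (Function.update S words r)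
      tmp' ((encodeWords [l ++ [false], l ++ [true]]).reverse ++ S tmp'))
      (14 * l.length + 10) := by
  refine ((advances_doubleBody_bits l (Γ'.comma :: r) hS).trans (Advances.single
    (a := Γ'.comma) (l := r) (S' := Function.update (Function.update S words r)
      tmp' ((encodeWords [l ++ [false], l ++ [true]]).reverse ++ S tmp'))
    (b := 12 * l.length + 9) (by simp) ?_)).mono (by omega)
  refine ((runs_block id (by decide) (by decide) ?_).seq ((Runs.push tmp' _ _).seq
    ((Runs.push tmp' _ _).seq ((runs_block id (by decide) (by decide) ?_).seq
    ((Runs.push tmp' _ _).seq ((Runs.push tmp' _ _).seq (runs_clear word _))))))).of_eq ?_ ?_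
  · simp [htmp]
  · simp [htmp]
  · funext x
    cases x <;> simp [encodeWords, hword]
  · simp [hword]
    omega

/-- Replace the list of words by the list of their extensions. -/
def doubleWords : StackProg Stk Γ' :=
  .loop words doubleBody ;; transfer id tmp' words

theorem runs_doubleWords {L : List (List Bool)} {n : ℕ} (hL : ∀ l ∈ L, l.length = n)
    {S : Stk → List Γ'} (hS : S words = encodeWords L) (htmp : S tmp = []) (htmp' : S tmp' = [])
    (hword : S word = []) :
    Runs doubleWords S (Function.update S words (encodeWords (double L)))
      (L.length * (18 * n + 18) + 2) := by
  have := (Advances.list (k := words) (f := doubleBody) (b := 14 * n + 10) (fun p q =>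
      Function.update (Function.update S words (encodeWords q))
        tmp' ((encodeWords (double p)).reverse)) L ?_).runs
    (by simp [encodeWords])
  · refine ((this.of_eq_left (S := S) ?_).seq
      (runs_transfer id (A := tmp') (B := words) (by decide) _)).of_eq ?_ ?_
    · funext x
      cases x <;> simp [htmp', encodeWords, double, hS]
    · funext x
      cases x <;> simp [htmp', encodeWords]
    · simp [length_encodeWords (length_of_mem_double hL), length_double]
      exact (by ring : _ = _).le
  · intro p l q hp
    obtain rfl := hL l (hp ▸ by simp)
    have := advances_doubleBody_word l (encodeWords q) (S := Function.update (Function.update S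
      words (encodeWords (l :: q))) tmp' ((encodeWords (double p)).reverse))
      (by simp [encodeWords_cons]) (by simp [htmp]) (by simp [hword])
    refine this.of_eq rfl ?_ le_rfl
    funext x
    cases x <;> simp [double, encodeWords]

/-- The bit strings of length `n`. -/
def allWords (n : ℕ) : List (List Bool) :=
  double^[n] [[]]

theorem allWords_succ (n : ℕ) : allWords (n + 1) = double (allWords n) :=
  Function.iterate_succ_apply' _ _ _

theorem length_allWords (n : ℕ) : (allWords n).length = 2 ^ n := by
  induction n with
  | zero => rfl
  | succ n ih => rw [allWords_succ, length_double, ih, pow_succ, mul_comm]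

theorem length_of_mem_allWords (n : ℕ) : ∀ l ∈ allWords n, l.length = n := by
  induction n with
  | zero => simp [allWords]
  | succ n ih =>
    rw [allWords_succ]
    exact length_of_mem_double ih

theorem runs_allWords {S : Stk → List Γ'} (hS : S words = []) (htmp : S tmp = [])
    (htmp' : S tmp' = []) (hword : S word = []) :
    Runs (.push words .comma ;; .loop pts fun _ => doubleWords) S
      (Function.update (Function.update S pts []) words (encodeWords (allWords (S pts).length)))
      ((S pts).length * (2 ^ (S pts).length * (18 * (S pts).length + 18) + 3) + 2) := by
  refine ((Runs.push words _ _).seq (Runs.loop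
    (b := 2 ^ (S pts).length * (18 * (S pts).length + 18) + 2) (S pts) (fun p r =>
    Function.update (Function.update S pts r) words (encodeWords (allWords p.length)))
    ?_ rfl ?_ ?_)).of_eq rfl (by ring_nf; omega)
  -- The initial comma encodes the list whose only entry is the empty word.
  · funext x
    cases x <;> simp [allWords, encodeWords, hS]
  · intro p r
    simp
  · intro p a r hp
    refine (runs_doubleWords (length_of_mem_allWords p.length) ?_ ?_ ?_ ?_).of_eq ?_ ?_
    · simp
    · simp [htmp]
    · simp [htmp']
    · simp [hword]
    · funext x
      cases x <;> simp [allWords_succ]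
    -- The cost of each doubling is bounded by that of full-length words, giving one bound for all
    -- iterations.
    · have : p.length ≤ (S pts).length := by simp [← hp]
      rw [length_allWords]
      gcongr
      norm_num

/-! #### Reading the input -/

/-- Read a symbol of the input. The flag is raised when the number `k` has been read. On `diag`
are the symbols that remain of a string that marks the diagonal. -/
def readBody : Γ' → StackProg Stk Γ'
  | .comma => .pop flag fun o => o.elim
      (.push flag .bra ;; .push diag .ket ;; .push pts .bra)
      fun _ => .push flag .bra ;; .push rows .comma ;; transfer id diag' diag ;; .push diag .bra
  | s => .pop flag fun o => o.elim
      (.push num .bra ;; .push pts .bra ;; .push pts .bra)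
      fun _ => .push flag .bra ;; .pop diag fun o' =>
        match o' with
        | none => .push rows s
        | some .ket => .push diag' .ket ;; .push rows .bra
        | some a => .push diag' a ;; .push rows s

theorem advances_readBody_num (k : ℕ) (r : List Γ') {S : Stk → List Γ'}
    (hS : S inp = List.replicate k (Γ'.bit true) ++ r) (hflag : S flag = []) :
    Advances inp readBody S (Function.update (Function.update (Function.update S inp r)
      num (List.replicate k Γ'.bra ++ S num)) pts (List.replicate (2 * k) Γ'.bra ++ S pts))
      (k * 5) := by
  have := Advances.list (k := inp) (f := readBody) (b := 5) (fun p q =>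
    Function.update (Function.update (Function.update S inp (q ++ r))
      num (List.replicate p.length Γ'.bra ++ S num))
      pts (List.replicate (2 * p.length) Γ'.bra ++ S pts)) (List.replicate k (Γ'.bit true)) ?_
  · refine this.of_eq ?_ (by simp) (by simp)
    funext x
    cases x <;> simp [hS]
  · intro p a q hp
    obtain rfl : a = Γ'.bit true := List.eq_of_mem_replicate (n := k) (hp ▸ by simp)
    refine Advances.single (a := Γ'.bit true) (l := q ++ r) (b := 4) (by simp)
      (Runs.pop (b := 3) ?_)
    simp only [ne_eq, reduceCtorEq, not_false_eq_true, Function.update_of_ne, hflag,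
      List.head?_nil, Option.elim]
    refine ((Runs.push num _ _).seq ((Runs.push pts _ _).seq (Runs.push pts _ _))).of_eq ?_ le_rfl
    funext x
    cases x <;> simp [hflag, List.replicate_succ, Nat.mul_succ]


/-- A row of the adjacency matrix, with the entry on the diagonal replaced by a mark. -/
def markRow (u : ℕ) (l : List Bool) : List Γ' :=
  (l.map Γ'.bit).set u Γ'.bra

/-- `List.set` does nothing out of range, so the mark appears exactly when the entry at position `u`
is appended. -/
theorem markRow_concat (u : ℕ) (l : List Bool) (a : Bool) :
    markRow u (l ++ [a]) = markRow u l ++ [if l.length = u then Γ'.bra else Γ'.bit a] := by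
  unfold markRow
  rw [List.map_append, List.set_append, List.length_map]
  split_ifs with h h' h'
  · omega
  · rfl
  · subst h'
    simp [List.set_eq_of_length_le]
  · obtain ⟨j, hj⟩ := Nat.exists_eq_add_of_le (not_lt.1 h)
    obtain ⟨i, rfl⟩ : ∃ i, j = i + 1 := ⟨j - 1, by omega⟩
    subst hj
    simp [List.set_eq_of_length_le]

theorem length_markRow (u : ℕ) (l : List Bool) : (markRow u l).length = l.length := by
  simp [markRow]

/-- The string that marks the diagonal in the row number `u`. -/
def diagMarks (u : ℕ) : List Γ' :=
  List.replicate u Γ'.bra ++ [Γ'.ket]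

theorem length_diagMarks (u : ℕ) : (diagMarks u).length = u + 1 := by
  simp [diagMarks]

theorem diagMarks_getElem?_lt {u i : ℕ} (h : i < u) : (diagMarks u)[i]? = some Γ'.bra := by
  rw [diagMarks, List.getElem?_append_left (by simpa using h)]
  simp [h]

theorem diagMarks_getElem?_self (u : ℕ) : (diagMarks u)[u]? = some Γ'.ket := by
  rw [diagMarks, List.getElem?_append_right (by simp)]
  simp

/-- The string on `diag` serves as a ruler: it loses one symbol per entry read, and these symbols
collect on `diag'`. -/
theorem advances_readBody_bits (u : ℕ) (l : List Bool) (r : List Γ') {S : Stk → List Γ'}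
    (hS : S inp = l.map Γ'.bit ++ r) (hflag : S flag = [Γ'.bra]) (hdiag : S diag = diagMarks u)
    (hdiag' : S diag' = []) :
    Advances inp readBody S (Function.update (Function.update (Function.update
      (Function.update S inp r) rows ((markRow u l).reverse ++ S rows))
      diag ((diagMarks u).drop l.length)) diag' ((diagMarks u).take l.length).reverse)
      (l.length * 6) := by
  have := Advances.list (k := inp) (f := readBody) (b := 6) (fun p q =>
    Function.update (Function.update (Function.update
      (Function.update S inp (q.map Γ'.bit ++ r)) rows ((markRow u p).reverse ++ S rows))
      diag ((diagMarks u).drop p.length)) diag' ((diagMarks u).take p.length).reverse) l ?_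
  · refine this.of_eq ?_ rfl le_rfl
    funext x
    cases x <;> simp [hS, markRow, hdiag, hdiag']
  · intro p a q _
    refine Advances.single (a := Γ'.bit a) (l := q.map Γ'.bit ++ r) (b := 5) (by simp)
      (Runs.pop (b := 4) ?_)
    simp only [ne_eq, reduceCtorEq, not_false_eq_true, Function.update_of_ne, hflag,
      List.head?_cons, Option.elim]
    refine (Runs.push flag _ _).seq (b' := 3) (Runs.pop (b := 2) ?_)
    simp only [ne_eq, reduceCtorEq, not_false_eq_true, Function.update_of_ne,
      Function.update_self, List.head?_drop]
    have htake := List.take_add_one (l := diagMarks u) (i := p.length)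
    have hlen := length_diagMarks u
    -- The top of `diag` is `bra` before the diagonal, `ket` on it, and absent after it.
    rcases lt_trichotomy p.length u with h | h | h
    · rw [diagMarks_getElem?_lt h] at htake ⊢
      refine ((Runs.push diag' _ _).seq (Runs.push rows _ _)).of_eq ?_ le_rfl
      funext x
      cases x <;> simp [hflag, htake, markRow_concat, h.ne]
    · subst h
      rw [diagMarks_getElem?_self] at htake ⊢
      refine ((Runs.push diag' _ _).seq (Runs.push rows _ _)).of_eq ?_ le_rfl
      funext x
      cases x <;> simp [hflag, htake, markRow_concat]
    · have hnone : (diagMarks u)[p.length]? = none := List.getElem?_eq_none (by omega)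
      rw [hnone] at htake ⊢
      refine (Runs.push rows _ _).of_eq ?_ (by omega)
      funext x
      cases x <;> simp [hflag, htake, markRow_concat, h.ne']

/-- Since `u < l.length`, the ruler is used up within the row. The comma moves it back and adds one
`bra`, which shifts the mark by one place. -/
theorem advances_readBody_row (u : ℕ) (l : List Bool) (r : List Γ') {S : Stk → List Γ'}
    (hu : u < l.length)
    (hS : S inp = l.map Γ'.bit ++ Γ'.comma :: r) (hflag : S flag = [Γ'.bra])
    (hdiag : S diag = diagMarks u) (hdiag' : S diag' = []) :
    Advances inp readBody S (Function.update (Function.update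
      (Function.update S inp r) rows ((markRow u l ++ [Γ'.comma]).reverse ++ S rows))
      diag (diagMarks (u + 1))) (8 * l.length + 6) := by
  have h₁ := advances_readBody_bits u l (Γ'.comma :: r) hS hflag hdiag hdiag'
  rw [List.drop_of_length_le (by rw [length_diagMarks]; omega),
    List.take_of_length_le (by rw [length_diagMarks]; omega)] at h₁
  refine (h₁.trans (Advances.single (b := 2 * l.length + 5) (a := Γ'.comma) (l := r)
    (S' := (Function.update (Function.update (Function.update S inp r)
      rows ((markRow u l ++ [Γ'.comma]).reverse ++ S rows))
      diag (diagMarks (u + 1)))) (by simp) (Runs.pop (b := 2 * l.length + 4) ?_))).mono (by omega)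
  simp only [ne_eq, reduceCtorEq, not_false_eq_true, Function.update_of_ne, hflag,
    List.head?_cons, Option.elim]
  refine ((Runs.push flag _ _).seq ((Runs.push rows _ _).seq
    ((runs_transfer id (by decide) _).seq (Runs.push diag _ _)))).of_eq ?_ ?_
  · funext x
    cases x <;> simp [hflag, hdiag', diagMarks, List.replicate_succ]
  · simp [length_diagMarks]
    omega

/-- The rows of the adjacency matrix, with the entries on the diagonal replaced by marks. -/
def markRows (L : List (List Bool)) : List (List Γ') :=
  L.mapIdx markRow

theorem markRows_concat (L : List (List Bool)) (l : List Bool) :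
    markRows (L ++ [l]) = markRows L ++ [markRow L.length l] := by
  simp [markRows, List.mapIdx_concat]

/-- Rows of cells as a string. -/
def joinRows (R : List (List Γ')) : List Γ' :=
  R.flatMap fun r => r ++ [Γ'.comma]

theorem joinRows_concat (R : List (List Γ')) (r : List Γ') :
    joinRows (R ++ [r]) = joinRows R ++ (r ++ [Γ'.comma]) := by
  simp [joinRows]

theorem advances_readBody_rows (L : List (List Bool)) (hL : ∀ l ∈ L, l.length = L.length)
    {S : Stk → List Γ'} (hS : S inp = encodeWords L) (hflag : S flag = [Γ'.bra])
    (hdiag : S diag = diagMarks 0) (hdiag' : S diag' = []) :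
    Advances inp readBody S (Function.update (Function.update
      (Function.update S inp []) rows ((joinRows (markRows L)).reverse ++ S rows))
      diag (diagMarks L.length)) (L.length * (8 * L.length + 6)) := by
  have := Advances.list (k := inp) (f := readBody) (b := 8 * L.length + 6) (fun p q =>
    Function.update (Function.update
      (Function.update S inp (encodeWords q)) rows ((joinRows (markRows p)).reverse ++ S rows))
      diag (diagMarks p.length)) L ?_
  · refine this.of_eq ?_ ?_ le_rfl
    · funext x
      cases x <;> simp [hS, joinRows, markRows, hdiag]
    · simp [encodeWords]
  · intro p l q hp
    have hl : l.length = L.length := hL l (hp ▸ by simp)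
    have hpl : p.length < L.length := by simp [← hp]
    refine (advances_readBody_row p.length l (encodeWords q) (hl.symm ▸ hpl) ?_ ?_ ?_ ?_).of_eq
      rfl ?_ (by rw [hl])
    · simp [encodeWords_cons]
    · simp [hflag]
    · simp
    · simp [hdiag']
    · funext x
      cases x <;> simp [markRows_concat, joinRows_concat]

/-- The cells of the rows of the concept class. -/
def cellsOf (L : List (List Bool)) : List Γ' :=
  joinRows (markRows L ++ [List.replicate L.length Γ'.ket])

/-- Write the cells of the last row, which stands for the concepts `c_h`. -/
def lastRowBody : Γ' → StackProg Stk Γ'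
  | .ket => .push rows .comma
  | _ => .push rows .ket

/-- Read the input, and initialize the stacks. -/
def readInput : StackProg Stk Γ' :=
  .loop inp readBody ;; clear flag ;; .loop diag lastRowBody

theorem runs_readInput (k : ℕ) (L : List (List Bool)) (hL : ∀ l ∈ L, l.length = L.length) :
    Runs readInput
      (Function.update (fun _ => []) inp
        (List.replicate k (Γ'.bit true) ++ Γ'.comma :: encodeWords L))
      (Function.update (Function.update (Function.update (fun _ => [])
        num (List.replicate k Γ'.bra)) pts (List.replicate (2 * k + 1) Γ'.bra))
        rows (cellsOf L).reverse)
      (5 * k + L.length * (8 * L.length + 8) + 15) := by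
  have h₁ := advances_readBody_num k (Γ'.comma :: encodeWords L) (S :=
    Function.update (fun _ => []) inp
      (List.replicate k (Γ'.bit true) ++ Γ'.comma :: encodeWords L)) (by simp) (by simp)
  have h₂ : Advances inp readBody (Function.update (Function.update (Function.update
      (fun _ => []) inp (Γ'.comma :: encodeWords L)) num (List.replicate k Γ'.bra))
      pts (List.replicate (2 * k) Γ'.bra)) (Function.update (Function.update (Function.update
      (Function.update (Function.update (fun _ => []) inp (encodeWords L))
      num (List.replicate k Γ'.bra)) pts (List.replicate (2 * k + 1) Γ'.bra))
      flag [Γ'.bra]) diag (diagMarks 0)) (4 + 1) := by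
    refine Advances.single (a := Γ'.comma) (l := encodeWords L) (by simp) (Runs.pop (b := 3) ?_)
    simp only [ne_eq, reduceCtorEq, not_false_eq_true, Function.update_of_ne,
      List.head?_nil, Option.elim]
    refine ((Runs.push flag _ _).seq ((Runs.push diag _ _).seq (Runs.push pts _ _))).of_eq ?_
      le_rfl
    funext x
    cases x <;> simp [diagMarks, List.replicate_succ]
  have h₃ := advances_readBody_rows L hL (S := (Function.update (Function.update (Function.update
      (Function.update (Function.update (fun _ => []) inp (encodeWords L))
      num (List.replicate k Γ'.bra)) pts (List.replicate (2 * k + 1) Γ'.bra))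
      flag [Γ'.bra]) diag (diagMarks 0))) (by simp) (by simp) (by simp) (by simp)
  have h₄ := ((h₁.of_eq rfl (by simp) le_rfl).trans (h₂.trans h₃)).runs (by simp)
  -- After all rows the ruler consists of as many `bra` as there are vertices, followed by a `ket`.
  -- Turning `bra` into `ket` and `ket` into a comma gives the last row of the template.
  have h₅ : Runs (.loop diag lastRowBody)
      (Function.update (Function.update (Function.update (Function.update (fun _ => [])
        num (List.replicate k Γ'.bra)) pts (List.replicate (2 * k + 1) Γ'.bra))
        rows (joinRows (markRows L)).reverse) diag (diagMarks L.length))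
      (Function.update (Function.update (Function.update (fun _ => [])
        num (List.replicate k Γ'.bra)) pts (List.replicate (2 * k + 1) Γ'.bra))
        rows (cellsOf L).reverse) (2 * L.length + 3) := by
    refine (Runs.loop (b := 1) (diagMarks L.length) (fun p r =>
      (Function.update (Function.update (Function.update (Function.update (fun _ => [])
        num (List.replicate k Γ'.bra)) pts (List.replicate (2 * k + 1) Γ'.bra))
        rows ((p.map fun a => if a = Γ'.ket then Γ'.comma else Γ'.ket).reverse ++
          (joinRows (markRows L)).reverse)) diag r)) ?_ ?_ ?_ ?_).mono ?_
    · simp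
    · funext x
      cases x <;> simp [diagMarks, cellsOf, joinRows_concat]
    · simp
    · intro p a r _
      have : lastRowBody a = .push rows (if a = Γ'.ket then Γ'.comma else Γ'.ket) := by
        cases a <;> simp [lastRowBody]
      rw [this]
      refine (Runs.push rows _ _).of_eq ?_ le_rfl
      funext x
      cases x <;> simp
    · rw [length_diagMarks]
      omega
  refine (h₄.seq ((runs_clear flag _).seq (h₅.of_eq_left ?_))).of_eq rfl ?_
  · funext x
    cases x <;> simp
  · simp
    ring_nf
    omega

/-! ### The whole program and its number of steps -/

/-- Write the concept class of the graph whose adjacency matrix is read. -/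
def program : StackProg Stk Γ' :=
  readInput ;; (.push words .comma ;; .loop pts fun _ => doubleWords) ;;
    .loop words writeBody ;; clear rows ;; .push out .comma ;; transfer (fun _ => .bit true) num out

theorem length_joinRows {R : List (List Γ')} {n : ℕ} (h : ∀ r ∈ R, r.length = n) :
    (joinRows R).length = R.length * (n + 1) := by
  induction R with
  | nil => simp [joinRows]
  | cons r R ih =>
    have := ih fun r' hr' => h r' (List.mem_cons_of_mem r hr')
    simp only [joinRows, List.flatMap_cons, List.length_append, List.length_cons,
      List.length_nil, h r List.mem_cons_self] at this ⊢
    rw [this]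
    ring

theorem length_cellsOf {L : List (List Bool)} (hL : ∀ l ∈ L, l.length = L.length) :
    (cellsOf L).length = (L.length + 1) * (L.length + 1) := by
  rw [cellsOf, length_joinRows (n := L.length)]
  · simp [markRows]
  · intro r hr
    rcases List.mem_append.1 hr with hr | hr
    · obtain ⟨i, hi, rfl⟩ := List.mem_mapIdx.1 hr
      rw [length_markRow]
      exact hL _ (List.getElem_mem hi)
    · rw [List.mem_singleton.1 hr, List.length_replicate]

/-- The output of the program: the number `k` and the rows of the concept class. -/
theorem runs_program (k : ℕ) (L : List (List Bool)) (hL : ∀ l ∈ L, l.length = L.length) :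
    Runs program
      (Function.update (fun _ => []) inp
        (List.replicate k (Γ'.bit true) ++ Γ'.comma :: encodeWords L))
      (Function.update (fun _ => []) out
        (List.replicate k (Γ'.bit true) ++ Γ'.comma ::
          (allWords (2 * k + 1)).reverse.flatMap (rowsFor k (cellsOf L))))
      (300 * ((k + 1) ^ 2 * (2 ^ (2 * k + 1) * (L.length + 1) ^ 2))) := by
  have h₁ := runs_readInput k L hL
  have h₂ := runs_allWords (S := (Function.update (Function.update (Function.update (fun _ => [])
        num (List.replicate k Γ'.bra)) pts (List.replicate (2 * k + 1) Γ'.bra))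
        rows (cellsOf L).reverse)) (by simp) (by simp) (by simp) (by simp)
  have h₃ := runs_writeBody (length_of_mem_allWords (2 * k + 1)) (S :=
    Function.update (Function.update (Function.update (fun _ => [])
      num (List.replicate k Γ'.bra)) rows (cellsOf L).reverse)
      words (encodeWords (allWords (2 * k + 1)))) (by simp) (by simp) (by simp) (by simp)
      (by simp) (by simp)
  refine (h₁.seq (h₂.seq ((h₃.of_eq_left ?_).seq ((runs_clear rows _).seq
    ((Runs.push out _ _).seq (runs_transfer _ (by decide) _)))))).of_eq ?_ ?_
  · funext x
    cases x <;> simp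
  · funext x
    cases x <;> simp
  · simp [length_cellsOf hL, length_allWords]
    -- Writing the power as `p + 1` makes both sides polynomials with natural coefficients, so the
    -- inequality can be checked monomial by monomial.
    obtain ⟨p, hp⟩ : ∃ p, 2 ^ (2 * k + 1) = p + 1 :=
      Nat.exists_eq_add_of_le' Nat.one_le_two_pow
    rw [hp]
    ring_nf
    omega


/-! ### Words as functions on the gadget -/

theorem count_ofFn {n : ℕ} (h : Fin n → Bool) :
    (List.ofFn h).count true = (Finset.univ.filter fun z => h z = true).card := by
  induction n with
  | zero => simp
  | succ n ih =>
    rw [List.ofFn_succ, List.count_cons, ih, Fin.card_filter_univ_succ]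
    cases h 0 <;> simp [add_comm]

theorem nodup_allWords (n : ℕ) : (allWords n).Nodup := by
  induction n with
  | zero => simp [allWords]
  | succ n ih =>
    rw [allWords_succ, double, List.nodup_flatMap]
    refine ⟨fun l _ => by simp, ih.imp fun {l l'} hne => ?_⟩
    intro w hw hw'
    rcases List.mem_pair.1 hw with rfl | rfl <;> rcases List.mem_pair.1 hw' with h | h <;>
      exact hne (List.append_inj_left' h rfl)

theorem mem_allWords {n : ℕ} {l : List Bool} : l ∈ allWords n ↔ l.length = n := by
  refine ⟨length_of_mem_allWords n l, fun h => ?_⟩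
  induction n generalizing l with
  | zero => simp [allWords, List.length_eq_zero_iff.1 h]
  | succ n ih =>
    rw [allWords_succ, double, List.mem_flatMap]
    have hne : l ≠ [] := List.ne_nil_of_length_eq_add_one h
    refine ⟨l.dropLast, ih (by simp [h]), ?_⟩
    rw [List.mem_pair]
    have hl := List.dropLast_append_getLast hne
    cases hb : l.getLast hne <;> rw [hb] at hl
    · exact Or.inl hl.symm
    · exact Or.inr hl.symm

/-- The function on `n` points that a word stands for. -/
def wordFn (n : ℕ) (l : List Bool) : Fin n → Bool :=
  fun i => l.reverse.getD i false

theorem ofFn_wordFn {n : ℕ} {l : List Bool} (hl : l.length = n) :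
    List.ofFn (wordFn n l) = l.reverse := by
  subst hl
  refine List.ext_getElem (by simp) fun i h h' => ?_
  have : i < l.length := by simpa using h
  simp [wordFn, this]

theorem wordFn_injective {n : ℕ} {l l' : List Bool} (hl : l.length = n) (hl' : l'.length = n)
    (h : wordFn n l = wordFn n l') : l = l' := by
  rw [← List.reverse_inj, ← ofFn_wordFn hl, ← ofFn_wordFn hl', h]

theorem wordFn_mem_gadget {k : ℕ} {l : List Bool} (hl : l.length = 2 * k + 1) :
    wordFn (2 * k + 1) l ∈ gadget k ↔ l.count true = k := by
  rw [← List.count_reverse, ← ofFn_wordFn hl, count_ofFn]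
  rfl

theorem exists_wordFn_eq {n : ℕ} (h : Fin n → Bool) : ∃ l : List Bool, l.length = n ∧
    wordFn n l = h := by
  have hl : (List.ofFn h).reverse.length = n := by simp
  refine ⟨(List.ofFn h).reverse, hl, List.ofFn_injective ?_⟩
  rw [ofFn_wordFn hl, List.reverse_reverse]

/-- A numbering of the domain: the points are grouped by the vertex. -/
def domainEquiv (N k : ℕ) :
    Fin (N * (2 * k + 1 + (2 * k + 1))) ≃ RedDomain (Fin N) k :=
  finProdFinEquiv.symm.trans (((Equiv.refl _).prodCongr finSumFinEquiv.symm).trans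
    ((Equiv.prodSumDistrib _ _ _).trans (Equiv.sumCongr (Equiv.refl _) (Equiv.prodComm _ _))))

theorem ofFn_comp_domainEquiv {N k : ℕ} (c : RedDomain (Fin N) k → Bool) :
    List.ofFn (c ∘ domainEquiv N k) = (List.ofFn fun v =>
      (List.ofFn fun z => c (Sum.inl (v, z))) ++ List.ofFn fun z => c (Sum.inr (z, v))).flatten := by
  rw [List.ofFn_mul]
  congr 2
  funext v
  rw [← List.ofFn_fin_append]
  congr 1
  funext j
  have hj : ∀ h, (⟨(v : ℕ) * (2 * k + 1 + (2 * k + 1)) + j, h⟩ :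
      Fin (N * (2 * k + 1 + (2 * k + 1)))) = finProdFinEquiv (v, j) := fun h =>
    Fin.ext (by simp [finProdFinEquiv]; ring)
  rw [hj]
  refine Fin.addCases (fun z => ?_) (fun z => ?_) j
  · simp [domainEquiv]
  · rw [Fin.append_right]
    simp only [domainEquiv, Equiv.trans_apply, Function.comp_apply, Equiv.symm_apply_apply,
      Equiv.prodCongr_apply, Prod.map_apply, finSumFinEquiv_symm_apply_natAdd]
    rfl

/-! ### The written string encodes the reduction class -/

section

variable {N : ℕ} (G : SimpleGraph (Fin N)) [DecidableRel G.Adj] (k : ℕ)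

/-- The adjacency matrix as a list of rows. -/
def adjRows : List (List Bool) :=
  List.ofFn fun i => List.ofFn fun j => decide (G.Adj i j)

theorem length_adjRows : (adjRows G).length = N := by
  simp [adjRows]

theorem encodeInstance_eq (k : ℕ) {m n : ℕ} (M : Fin m → Fin n → Bool) :
    encodeInstance k M = List.replicate k (Γ'.bit true) ++
      Γ'.comma :: encodeWords (List.ofFn fun i => List.ofFn (M i)) := by
  simp [encodeInstance, encodeWords, List.flatMap, List.map_ofFn, Function.comp_def]

theorem markRows_adjRows : markRows (adjRows G) = List.ofFn fun u => List.ofFn fun v =>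
    if v = u then Γ'.bra else Γ'.bit (decide (G.Adj u v)) := by
  refine List.ext_getElem (by simp [markRows, adjRows]) fun u hu hu' => ?_
  refine List.ext_getElem (by simp [markRows, adjRows, markRow]) fun v hv hv' => ?_
  simp [markRows, adjRows, markRow, List.getElem_set, Fin.ext_iff, eq_comm]

/-- The rows that are written for the function `h`. -/
def conceptRows (h : Fin (2 * k + 1) → Bool) :
    List (Fin (N * (2 * k + 1 + (2 * k + 1))) → Bool) :=
  (List.ofFn fun u => vertexConcept G u h ∘ domainEquiv N k) ++
    [constraintConcept (Fin N) h ∘ domainEquiv N k]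

theorem flatMap_emitted_joinRows (w : List Γ') (R : List (List Γ')) :
    (joinRows R).flatMap (emitted w) =
      R.flatMap fun r => r.flatMap (emitted w) ++ [Γ'.comma] := by
  simp [joinRows, List.flatMap_assoc, emitted]

/-- Both sides split into one block per vertex `v`. The diagonal mark handles `v = u`; elsewhere
symmetry of adjacency lets the entry `(u, v)` decide whether `v` dominates `u`. -/
theorem emitted_vertexRow (h : Fin (2 * k + 1) → Bool) (u : Fin N) :
    (List.ofFn fun v => if v = u then Γ'.bra else Γ'.bit (decide (G.Adj u v))).flatMap
      (emitted ((List.ofFn h).map Γ'.bit)) =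
    (List.ofFn (vertexConcept G u h ∘ domainEquiv N k)).map Γ'.bit := by
  simp only [ofFn_comp_domainEquiv, List.map_flatten, List.flatMap, List.map_ofFn]
  congr 2
  funext v
  by_cases hv : v = u
  · subst hv
    simp [emitted, vertexConcept, Dominates, List.map_ofFn, Function.comp_def]
  · have hv' : u ≠ v := Ne.symm hv
    by_cases hadj : G.Adj u v
    · simp [hv, hv', emitted, vertexConcept, Dominates, Function.comp_def, hadj, hadj.symm]
    · have hadj' : ¬ G.Adj v u := fun h => hadj h.symm
      simp [hv, hv', emitted, vertexConcept, Dominates, Function.comp_def, hadj, hadj']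

theorem emitted_constraintRow (h : Fin (2 * k + 1) → Bool) :
    (List.replicate N Γ'.ket).flatMap (emitted ((List.ofFn h).map Γ'.bit)) =
    (List.ofFn (constraintConcept (Fin N) h ∘ domainEquiv N k)).map Γ'.bit := by
  simp only [ofFn_comp_domainEquiv, List.map_flatten, List.flatMap, List.map_ofFn,
    ← List.ofFn_const]
  congr 2
  funext v
  simp [emitted, constraintConcept, List.map_ofFn, Function.comp_def]

/-- The rows of the concept class, in the order in which they are written. -/
def classRows : List (Fin (N * (2 * k + 1 + (2 * k + 1))) → Bool) :=
  (allWords (2 * k + 1)).reverse.flatMap fun l =>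
    if l.count true = k then conceptRows G k (wordFn (2 * k + 1) l) else []

/-- The order of `classRows` copies that of the program. The double reversal of bits, in `rowsFor`
and in `wordFn`, makes both sides speak of the same function. -/
theorem encodeWords_classRows : encodeWords ((classRows G k).map List.ofFn) =
    (allWords (2 * k + 1)).reverse.flatMap (rowsFor k (cellsOf (adjRows G))) := by
  rw [classRows, List.map_flatMap, encodeWords, List.flatMap_assoc]
  refine List.flatMap_congr fun l hl => ?_
  rw [List.mem_reverse, mem_allWords] at hl
  unfold rowsFor
  split_ifs
  · rw [cellsOf, flatMap_emitted_joinRows, ← List.map_reverse, ← ofFn_wordFn hl, length_adjRows,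
      markRows_adjRows, List.flatMap_append, conceptRows, List.map_append, List.flatMap_append]
    congr 1
    · simp only [List.flatMap, List.map_ofFn]
      congr 2
      funext u
      simp only [Function.comp_apply]
      rw [← emitted_vertexRow]
      simp only [List.flatMap, List.map_ofFn]
    · simp only [List.flatMap_cons, List.flatMap_nil, List.map_cons, List.map_nil,
        emitted_constraintRow]
  · rfl

theorem mem_classRows {c : Fin (N * (2 * k + 1 + (2 * k + 1))) → Bool} :
    c ∈ classRows G k ↔ ∃ c' ∈ reductionClass G k, c' ∘ domainEquiv N k = c := by
  constructor
  · intro hc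
    obtain ⟨l, hl, hc⟩ := List.mem_flatMap.1 hc
    rw [List.mem_reverse, mem_allWords] at hl
    split_ifs at hc with hk
    · have hg := (wordFn_mem_gadget hl).2 hk
      rcases List.mem_append.1 hc with hc | hc
      · obtain ⟨u, rfl⟩ := List.mem_ofFn.1 hc
        exact ⟨_, Or.inr ⟨u, _, hg, rfl⟩, rfl⟩
      · rw [List.mem_singleton.1 hc]
        exact ⟨_, Or.inl ⟨_, hg, rfl⟩, rfl⟩
    · exact absurd hc List.not_mem_nil
  · have key : ∀ h ∈ gadget k, c ∈ conceptRows G k h → c ∈ classRows G k := by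
      intro h hh hc
      obtain ⟨l, hl, rfl⟩ := exists_wordFn_eq h
      refine List.mem_flatMap.2 ⟨l, List.mem_reverse.2 (mem_allWords.2 hl), ?_⟩
      rwa [if_pos ((wordFn_mem_gadget hl).1 hh)]
    rintro ⟨_, ⟨h, hh, rfl⟩ | ⟨u, h, hh, rfl⟩, rfl⟩
    · exact key h hh (List.mem_append_right _ (List.mem_singleton_self _))
    · exact key h hh (List.mem_append_left _ (List.mem_ofFn.2 ⟨u, rfl⟩))

/-! ### The rows are pairwise distinct -/

variable {k}

/-- A one of `h` reveals the vertex. For `k = 0` there is none, and vertices with equal closed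
neighbourhoods give equal concepts. -/
theorem vertexConcept_inj {u u' : Fin N} {h h' : Fin (2 * k + 1) → Bool} (hk : 0 < k)
    (hh : h ∈ gadget k) (heq : vertexConcept G u h = vertexConcept G u' h') : u = u' ∧ h = h' := by
  obtain ⟨z, hz⟩ : (onesOf h).Nonempty := Finset.card_pos.1 (hh.symm ▸ hk)
  have hu := congrFun heq (Sum.inr (z, u))
  simp only [vertexConcept, Sum.elim_inr, mem_onesOf.1 hz, and_self, decide_true] at hu
  obtain rfl := (of_decide_eq_true hu.symm).2
  refine ⟨rfl, funext fun z => ?_⟩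
  simpa [vertexConcept] using congrFun heq (Sum.inr (z, u'))

theorem constraintConcept_ne_vertexConcept {u : Fin N} {h h' : Fin (2 * k + 1) → Bool}
    (hh' : h' ∈ gadget k) : constraintConcept (Fin N) h ≠ vertexConcept G u h' := by
  intro heq
  obtain ⟨z, hz⟩ := exists_notMem_onesOf hh'
  have := congrFun heq (Sum.inr (z, u))
  exact hz (mem_onesOf.2 (by simpa [vertexConcept, constraintConcept] using this))

theorem constraintConcept_injective (hN : 0 < N) :
    Function.Injective (constraintConcept (Fin N) (k := k)) :=
  fun _ _ heq => funext fun z => congrFun heq (Sum.inl (⟨0, hN⟩, z))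

theorem nodup_classRows (hk : 0 < k) (hN : 0 < N) : (classRows G k).Nodup := by
  have hcomp : Function.Injective fun c : RedDomain (Fin N) k → Bool => c ∘ domainEquiv N k :=
    (domainEquiv N k).surjective.injective_comp_right
  rw [classRows, List.nodup_flatMap]
  constructor
  · intro l hl
    rw [List.mem_reverse, mem_allWords] at hl
    split_ifs with hc
    · have hg := (wordFn_mem_gadget hl).2 hc
      refine List.Nodup.append (List.nodup_ofFn.2 fun u u' heq => ?_) (List.nodup_singleton _) ?_
      · exact (vertexConcept_inj G hk hg (hcomp heq)).1
      · rw [List.disjoint_singleton]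
        rintro hmem
        obtain ⟨u, hu⟩ := List.mem_ofFn.1 hmem
        exact constraintConcept_ne_vertexConcept G hg (hcomp hu).symm
    · exact List.nodup_nil
  · refine List.Pairwise.imp_of_mem ?_ (List.nodup_reverse.2 (nodup_allWords (2 * k + 1)))
    intro l l' hl hl' hne c hc hc'
    rw [List.mem_reverse, mem_allWords] at hl hl'
    dsimp only at hc hc'
    split_ifs at hc hc' with h h'
    · have hg := (wordFn_mem_gadget hl).2 h
      have hg' := (wordFn_mem_gadget hl').2 h'
      refine hne (wordFn_injective hl hl' ?_)
      rcases List.mem_append.1 hc with hc | hc <;> rcases List.mem_append.1 hc' with hc' | hc'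
      · obtain ⟨u, rfl⟩ := List.mem_ofFn.1 hc
        obtain ⟨u', hu'⟩ := List.mem_ofFn.1 hc'
        exact (vertexConcept_inj G hk hg (hcomp hu'.symm)).2
      · obtain ⟨u, rfl⟩ := List.mem_ofFn.1 hc
        exact absurd (hcomp (List.mem_singleton.1 hc').symm)
          (constraintConcept_ne_vertexConcept G hg)
      · obtain ⟨u, rfl⟩ := List.mem_ofFn.1 hc'
        exact absurd (hcomp (List.mem_singleton.1 hc).symm)
          (constraintConcept_ne_vertexConcept G hg')
      · exact constraintConcept_injective hN
          (hcomp ((List.mem_singleton.1 hc).symm.trans (List.mem_singleton.1 hc')))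
    all_goals simp_all

end

theorem time_le (k N : ℕ) : 300 * ((k + 1) ^ 2 * (2 ^ (2 * k + 1) * (N + 1) ^ 2)) + 1 ≤
    2 ^ (10 * (k + 1)) * (N + 1) ^ 10 := by
  have hk : (k + 1) ^ 2 ≤ (2 ^ k) ^ 2 := Nat.pow_le_pow_left Nat.lt_two_pow_self 2
  have hpos : 0 < (2 ^ k) ^ 4 * (N + 1) ^ 2 := by positivity
  calc 300 * ((k + 1) ^ 2 * (2 ^ (2 * k + 1) * (N + 1) ^ 2)) + 1
      ≤ 300 * ((2 ^ k) ^ 2 * (2 ^ (2 * k + 1) * (N + 1) ^ 2)) + 1 := by gcongr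
    _ = 600 * ((2 ^ k) ^ 4 * (N + 1) ^ 2) + 1 := by ring
    -- The slack between 600 and 1024, times a positive number, absorbs the additional step; 1024 is
    -- the factor `2 ^ 10` of the target.
    _ ≤ 1024 * ((2 ^ k) ^ 4 * (N + 1) ^ 2) := by omega
    _ ≤ 1024 * ((2 ^ k) ^ 10 * (N + 1) ^ 10) := by
      gcongr
      · exact Nat.one_le_two_pow
      · norm_num
      · omega
      · norm_num
    _ = 2 ^ (10 * (k + 1)) * (N + 1) ^ 10 := by ring

theorem outputsWithin_program {N : ℕ} (G : SimpleGraph (Fin N)) [DecidableRel G.Adj] (k : ℕ) :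
    OutputsWithin (StackProg.machine .inp .out program) (encodeGraphInstance G k)
      (encodeInstance k (classRows G k).get) (2 ^ (10 * (k + 1)) * (N + 1) ^ 10) := by
  have h := StackProg.outputsWithin_machine (runs_program k (adjRows G) (by
    intro l hl
    obtain ⟨i, rfl⟩ := List.mem_ofFn.1 hl
    rw [length_adjRows, List.length_ofFn]))
  rw [← encodeWords_classRows, length_adjRows] at h
  have hout : (List.ofFn fun i => List.ofFn ((classRows G k).get i)) =
      (classRows G k).map List.ofFn := by
    conv_rhs => rw [← List.ofFn_get (classRows G k), List.map_ofFn]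
    rfl
  rw [encodeGraphInstance, encodeInstance_eq, encodeInstance_eq, hout]
  obtain ⟨h⟩ := h
  exact ⟨h.toEvalsTo, h.steps_le_m.trans (time_le k N)⟩

end ReductionProgram

/-- Supersets of dominating sets dominate, so a small one can be padded to size `k` when there are
enough vertices. -/
theorem exists_isDominatingSet_card_eq_iff {V : Type} [Fintype V] {G : SimpleGraph V} {k : ℕ}
    (hk : k ≤ Fintype.card V) : (∃ T : Finset V, IsDominatingSet G T ∧ T.card = k) ↔
      ∃ T : Finset V, IsDominatingSet G T ∧ T.card ≤ k := by
  constructor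
  · rintro ⟨T, hT, rfl⟩
    exact ⟨T, hT, le_rfl⟩
  · rintro ⟨T, hT, hTk⟩
    obtain ⟨T', hTT', hT'⟩ := Finset.exists_superset_card_eq hTk hk
    refine ⟨T', fun v => ?_, hT'⟩
    obtain ⟨u, hu, huv⟩ := hT v
    exact ⟨u, hTT' hu, huv⟩

theorem theorem3 :
    ∃ (M : Turing.TM2ComputableAux Computability.Γ' Computability.Γ') (a : ℕ),
      ∀ (N k : ℕ) (G : SimpleGraph (Fin N)) [DecidableRel G.Adj],
        ∃ (m n : ℕ) (A : Fin m → Fin n → Bool),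
          -- the machine maps `(G, k)` to `(A, k)` in time `2^{O(k)} N^{O(1)}`
          OutputsWithin M (encodeGraphInstance G k) (encodeInstance k A)
            (2 ^ (a * (k + 1)) * (N + 1) ^ a) ∧
          -- up to a numbering of the domain, the rows of `A` are the concepts of the class
          (∃ e : Fin n ≃ RedDomain (Fin N) k,
            Set.range A = (fun c => c ∘ e) '' reductionClass G k) ∧
          (0 < k → 0 < N → Function.Injective A) ∧
          -- correctness
          ((∃ T : Finset (Fin N), IsDominatingSet G T ∧ T.card ≤ k) ↔
            recursiveTeachingDim (Set.range A) ≤ k) ∧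
          (k ≤ N →
            ((∃ T : Finset (Fin N), IsDominatingSet G T ∧ T.card = k) ↔
              recursiveTeachingDim (Set.range A) ≤ k)) := by
  refine ⟨StackProg.machine .inp .out ReductionProgram.program, 10, fun N k G _ => ?_⟩
  have hrange : Set.range (ReductionProgram.classRows G k).get =
      (fun c => c ∘ ReductionProgram.domainEquiv N k) '' reductionClass G k := by
    ext c
    rw [Set.range_list_get]
    exact ReductionProgram.mem_classRows G k
  have hiff : (∃ T : Finset (Fin N), IsDominatingSet G T ∧ T.card ≤ k) ↔
      recursiveTeachingDim (Set.range (ReductionProgram.classRows G k).get) ≤ k := by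
    rw [hrange, recursiveTeachingDim_image_comp]
    exact exists_isDominatingSet_iff_recursiveTeachingDim_le G
  refine ⟨_, _, (ReductionProgram.classRows G k).get,
    ReductionProgram.outputsWithin_program G k, ⟨_, hrange⟩,
    fun hk hN => (ReductionProgram.nodup_classRows G hk hN).injective_get, hiff, fun hkN => ?_⟩
  rw [← hiff]
  exact exists_isDominatingSet_card_eq_iff (by simpa using hkN)
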